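/- Let $M$ be a Hausdorff smooth $n$-dimensional manifold without boundary, $U$ a non-empty set, and $(V_u)_{u\in U}$ a family of smooth vector fields on $M$, each generating a one-parameter group of diffeomorphisms $P_u^t$, $t\in\mathbb R$. Fix a class of admissible controls $u:\mathbb R\to U$ that contains the constants, is closed under time shifts and under switching from one control to another, and whose members make $V_{u(t)}$ measurable and locally integrable in $t$ (in charts, locally in space: measurable in $t$, bounded and Lipschitz in $x$ with constants integrable in $t$). A trajectory is an absolutely continuous solution of $\dot q(t)=V_{u(t)}(q(t))$ a.e. on an interval $[0,T]$ with admissible $u$, and $\mathcal O^+(p)$ is the set of end points of trajectories that start at $p$. Let $q\in M$, and let $u_1,\dots,u_d\in U$ and a finite set of iterated commutators $[V_{u_{i_1}},[V_{u_{i_2}},[\dots,V_{u_{i_k}}]]]$ be such that the vector fields $V_{u_1},\dots,V_{u_d}$ and these commutators, evaluated at $q$, span $T_qM$ (the Lie algebra rank condition at $q$). Expanding a commutator as a differential operator gives monomials $V_{u_{j_1}}\circ\dots\circ V_{u_{j_k}}$; to each there belongs the elementary product $P_{u_{j_1}}^{t_1}\circ\dots\circ P_{u_{j_k}}^{t_k}$,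 and each $V_{u_i}$ is its own only monomial. A chronological product $\mathcal G(t_1,\dots,t_N)=P^{t_1}_{u_{i_1}}\circ\dots\circ P^{t_N}_{u_{i_N}}$ is called general if it is a composition, with independent times, of elementary products belonging to the chosen generators and commutators, in which each of these elementary products occurs. Its exceptional set $\Omega\subset\mathbb R^N$ consists of the $t$ at which the differential of $t\mapsto\mathcal G(t)(q)$ is not surjective. Let $G^-_q$ be the set of all points $\mathcal G(t_1,\dots,t_N)(q)$ with $\mathcal G$ general, all $t_i<0$ and $t\notin\Omega$. A trajectory $q(t)$, $0\le t\le T$, ending at $q$ is called general if $q(s)\in G^-_q$ for some $0\le s<T$. Then $G^-_q$ is a non-empty open subset of $M$, and $q\in\mathcal O^+(p)$ for every $p\in G^-_q$. Moreover, if $q(t)$, $0\le t\le t_q$, is a closed trajectory with $q(0)=q(t_q)=q$ that is general, then there is an open neighbourhood $B^-_q$ of $\{q(t):0\le t\le t_q\}$ such that $q\in\mathcal O^+(q')$ for all $q'\in B^-_q$. -/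

import Mathlib

open scoped Manifold ContDiff Topology
open Set MeasureTheory

/-- A control system `q' = V_u(q)`, `u ∈ U`, on an `n`-dimensional manifold `M` without boundary:
smooth vector fields `V u`, each of which generates a one-parameter group of diffeomorphisms
`flow u` (a smooth action of `ℝ` on `M` whose orbits are the integral curves of `V u`). -/
structure ControlSystem (U : Type*) (n : ℕ) (M : Type*) [TopologicalSpace M]
    [ChartedSpace (EuclideanSpace ℝ (Fin n)) M] [IsManifold (𝓡 n) ∞ M] where
  /-- the control vector fields -/
  V : U → (x : M) → TangentSpace (𝓡 n) x
  smooth_V : ∀ u, ContMDiff (𝓡 n) (𝓡 n).tangent ∞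
    (fun x => (⟨x, V u x⟩ : TangentBundle (𝓡 n) M))
  /-- the one-parameter groups `P_u^t` -/
  flow : U → ℝ → M → M
  flow_zero : ∀ u x, flow u 0 x = x
  flow_add : ∀ u s t x, flow u (s + t) x = flow u s (flow u t x)
  smooth_flow : ∀ u, ContMDiff (𝓘(ℝ, ℝ).prod (𝓡 n)) (𝓡 n) ∞
    (fun p : ℝ × M => flow u p.1 p.2)
  integralCurve_flow : ∀ u x, IsMIntegralCurve (fun t => flow u t x) (V u)

namespace ControlSystem

section

variable {U : Type*} {n : ℕ} {M : Type*} [TopologicalSpace M]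
  [ChartedSpace (EuclideanSpace ℝ (Fin n)) M] [IsManifold (𝓡 n) ∞ M]
  (S : ControlSystem U n M)

/-! ### Controls and trajectories -/

/-- The vector `V_u(x)` written in the coordinates of the chart at `c`. -/
noncomputable def coordV (c : M) (u : U) (x : M) : EuclideanSpace ℝ (Fin n) :=
  tangentCoordChange (𝓡 n) x c x (S.V u x)

/-- The time-dependent vector field `V_{u(t)}` is measurable and locally integrable in `t`
(the Carathéodory conditions): locally in every chart it is measurable in `t`, and it is bounded and
Lipschitz in the space variable with constants that are integrable in `t`. -/
def IsLocallyIntegrableControl (u : ℝ → U) : Prop :=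
  ∀ c p : M, p ∈ (chartAt (EuclideanSpace ℝ (Fin n)) c).source → ∀ a b : ℝ, a ≤ b →
    ∃ K ∈ 𝓝 (chartAt (EuclideanSpace ℝ (Fin n)) c p), ∃ m : ℝ → ℝ,
      IntervalIntegrable m volume a b ∧
      (∀ y ∈ K, AEStronglyMeasurable
        (fun t => S.coordV c (u t) ((chartAt (EuclideanSpace ℝ (Fin n)) c).symm y))
        (volume.restrict (Ioc a b))) ∧
      ∀ᵐ t ∂(volume.restrict (Ioc a b)),
        (∀ y ∈ K,
          ‖S.coordV c (u t) ((chartAt (EuclideanSpace ℝ (Fin n)) c).symm y)‖ ≤ m t) ∧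
        ∀ y ∈ K, ∀ z ∈ K,
          ‖S.coordV c (u t) ((chartAt (EuclideanSpace ℝ (Fin n)) c).symm y)
            - S.coordV c (u t) ((chartAt (EuclideanSpace ℝ (Fin n)) c).symm z)‖
            ≤ m t * ‖y - z‖

/-- A class of admissible controls: it contains the constant controls, it is closed under time
shifts and under switching from one control to another (so it contains the piecewise constant
controls), and each of its members is locally integrable. Piecewise constant controls and all
locally integrable controls are the extreme examples. -/
structure IsAdmissibleClass (A : Set (ℝ → U)) : Prop where
  const_mem : ∀ v : U, (fun _ => v) ∈ A
  shift_mem : ∀ u ∈ A, ∀ s : ℝ, (fun t => u (t + s)) ∈ A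
  switch_mem : ∀ u ∈ A, ∀ v ∈ A, ∀ s : ℝ, (fun t => if t < s then u t else v (t - s)) ∈ A
  locallyIntegrable : ∀ u ∈ A, S.IsLocallyIntegrableControl u

/-- On `[a, b]` the curve `γ` stays in the domain of the chart at `c` and solves
`γ'(t) = V_{u(t)}(γ(t))` there in integral form, i.e. it is absolutely continuous and satisfies the
equation for almost every `t`. -/
def SolvesInChart (c : M) (u : ℝ → U) (γ : ℝ → M) (a b : ℝ) : Prop :=
  a ≤ b ∧ ContinuousOn γ (Icc a b) ∧
  (∀ t ∈ Icc a b, γ t ∈ (chartAt (EuclideanSpace ℝ (Fin n)) c).source) ∧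
  IntervalIntegrable (fun r => S.coordV c (u r) (γ r)) volume a b ∧
  ∀ t ∈ Icc a b, chartAt (EuclideanSpace ℝ (Fin n)) c (γ t) =
    chartAt (EuclideanSpace ℝ (Fin n)) c (γ a) + ∫ r in a..t, S.coordV c (u r) (γ r)

/-- `γ`, restricted to `[0, T]`, is a trajectory of the system under the control `u`:
`[0, T]` splits into finitely many intervals on each of which `γ` lies in a chart and solves
`γ'(t) = V_{u(t)}(γ(t))`. -/
def IsTrajectory (u : ℝ → U) (γ : ℝ → M) (T : ℝ) : Prop :=
  ∃ (k : ℕ) (τ : ℕ → ℝ) (c : ℕ → M), τ 0 = 0 ∧ τ k = T ∧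
    ∀ i < k, S.SolvesInChart (c i) u γ (τ i) (τ (i + 1))

/-- The positive orbit `𝒪⁺(p)`: the points reachable from `p` by trajectories whose controls belong
to the class `A`. -/
def reachable (A : Set (ℝ → U)) (p : M) : Set M :=
  {x | ∃ u ∈ A, ∃ (γ : ℝ → M) (T : ℝ), S.IsTrajectory u γ T ∧ γ 0 = p ∧ γ T = x}

/-! ### Generators and their commutators

Words are lists of indices of the generators `V_{g 0}, …, V_{g (d-1)}`. -/

variable {d : ℕ} (g : Fin d → U)

/-- The iterated commutator `[V_{i₁}, [V_{i₂}, [ … , V_{iₖ}]]]` of the word `i₁ i₂ … iₖ`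
(the vector field `V_{i₁}` itself if `k = 1`). -/
noncomputable def commutator : List (Fin d) → (x : M) → TangentSpace (𝓡 n) x
  | [] => 0
  | [i] => S.V (g i)
  | i :: j :: w => VectorField.mlieBracket (𝓡 n) (S.V (g i)) (commutator (j :: w))

/-- The words of the complete system: the one-letter words, which stand for the generators
themselves, and the words in `C`, which stand for commutators of generators. -/
def systemWords (C : Finset (List (Fin d))) : Set (List (Fin d)) :=
  {w | (∃ i, w = [i]) ∨ w ∈ C}

/-- The Lie algebra rank condition at `q`, witnessed by the generators `g` and their commutators
listed in `C`: these vector fields, evaluated at `q`, span the tangent space. -/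
def SatisfiesLARC (C : Finset (List (Fin d))) (q : M) : Prop :=
  Submodule.span ℝ {v : TangentSpace (𝓡 n) q |
    ∃ w ∈ systemWords C, v = S.commutator g w q} = ⊤

/-! ### General chronological products -/

/-- The chronological product `P^{t₁}_{i₁} ∘ … ∘ P^{t_N}_{i_N}` of the word `i₁ … i_N`, at `x`. -/
def chron (w : List (Fin d)) (t : Fin w.length → ℝ) (x : M) : M :=
  (List.ofFn fun i => S.flow (g (w.get i)) (t i)).foldr (fun P y => P y) x

/-- The words of the differential monomials `V_{j₁} ∘ … ∘ V_{jₖ}` in the expansion of the iterated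
commutator of a word, e.g. `[A, [B, C]] = ABC - BCA - ACB + CBA`. -/
def monomials : List (Fin d) → Set (List (Fin d))
  | [] => ∅
  | [i] => {[i]}
  | i :: j :: w => {m | ∃ m' ∈ monomials (j :: w), m = i :: m' ∨ m = m' ++ [i]}

/-- The chronological product of `w` is general relative to the given system: it is a composition
of the elementary products that belong to the monomials of the commutators of the system, and each
of these elementary products occurs in it. -/
def IsGeneralWord (C : Finset (List (Fin d))) (w : List (Fin d)) : Prop :=
  ∃ L : List (List (Fin d)), w = L.flatten ∧
    ∀ m, m ∈ L ↔ ∃ v ∈ systemWords C, m ∈ monomials v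

/-- The exceptional set `Ω ⊆ ℝ^N` of a chronological product at `q`: the points at which the
differential of `t ↦ P^{t₁}_{i₁} ∘ … ∘ P^{t_N}_{i_N} (q)` is not a surjection. -/
def exceptionalSet (w : List (Fin d)) (q : M) : Set (Fin w.length → ℝ) :=
  {t | ¬ Function.Surjective
    (mfderiv 𝓘(ℝ, Fin w.length → ℝ) (𝓡 n) (fun s => S.chron g w s q) t)}

/-- The points `q(t₁, …, t_N)`, all `tᵢ` negative and `t ∉ Ω`, from which general trajectories
lead to `q`. -/
def negGeneralPoints (C : Finset (List (Fin d))) (q : M) : Set M :=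
  {p | ∃ w, IsGeneralWord C w ∧ ∃ t : Fin w.length → ℝ,
    (∀ i, t i < 0) ∧ t ∉ S.exceptionalSet g w q ∧ p = S.chron g w t q}

/-- A trajectory `γ` on `[0, T]` that ends at `q` is general (for negative times): a final interval
of it goes to `q = γ(T)` from a point `q(t₁, …, t_N)` of a general chronological product with all
`tᵢ` negative and `t ∉ Ω`. -/
def IsGeneralInto (C : Finset (List (Fin d))) (q : M) (γ : ℝ → M) (T : ℝ) : Prop :=
  γ T = q ∧ ∃ s, 0 ≤ s ∧ s < T ∧ γ s ∈ S.negGeneralPoints g C q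

end

end ControlSystem

/-!
Regular negative times of some general chronological product exist by the following maximal rank
argument. Among all chronological products `F(t) = P^{t₁} ∘ … ∘ P^{t_N} (q)` with negative times
that end near `q`, take one whose differential has the largest rank, with range `E` at the end
point `x`. Applying one more flow `P_i^r`, `r < 0` small, cannot increase the rank, so the new range
is the transported space `dP_i^r E`; it contains `V_i`, since `r` is one of the times. Hence the
set of vector fields that lie in the range at all points of maximal rank contains every `V_i`
(let `r → 0`) and is closed under brackets with `V_i`: the bracket is the derivative at `r = 0` of the
pull-back `(dP_i^r)⁻¹ X`, which stays in the fixed subspace `E`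
(`mem_and_lieBracket_mem_of_flow`). All commutators therefore lie in `E`, and `E` is the whole tangent
space because the rank condition persists near `q`
(`ControlSystem.exists_notMem_exceptionalSet`). Putting further flows in front keeps the
differential onto, so the product can be completed to a general one. Openness of the set of general
points is the inverse function theorem together with the openness of surjectivity; `q` is reachable
from them because the negative times can be undone by flowing forwards.

For the statement on closed trajectories let `B` be the set of points from which `q` is reachable.
The interior of `B` propagates backwards along trajectories
(`ControlSystem.IsTrajectory.mem_interior_of_le`): solutions of the Carathéodory equation that start
near a trajectory exist and follow it (`exists_caratheodory_solution_near`, a contraction argument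
on short intervals, glued by a Lebesgue number). The general point `γ s` is interior to `B`, hence so
is `γ 0 = q = γ T`, and hence so is every point of the trajectory.
-/

/-! ### Relations on intervals -/

/-- A reflexive and transitive relation on `[a, b]` that holds locally, from earlier to later
times, holds from every time to every later one (a Lebesgue number argument). -/
theorem rel_of_local_of_le {R : ℝ → ℝ → Prop} {a b : ℝ} (hrefl : ∀ t, R t t)
    (htrans : ∀ r s t, R r s → R s t → R r t)
    (hloc : ∀ τ ∈ Icc a b, ∃ δ > 0, ∀ s t, a ≤ s → s ≤ t → t ≤ b → |s - τ| < δ → |t - τ| < δ →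
      R s t) {s t : ℝ} (has : a ≤ s) (hst : s ≤ t) (htb : t ≤ b) : R s t := by
  choose! δ hδ hR using hloc
  have hsub : ∀ x : Icc s t, (x : ℝ) ∈ Icc a b := fun x => ⟨has.trans x.2.1, x.2.2.trans htb⟩
  obtain ⟨σ, h0, hmono, ⟨m, hm⟩, hcov⟩ := exists_monotone_Icc_subset_open_cover_Icc hst
    (c := fun x : Icc s t => Metric.ball x (δ x)) (fun x => Metric.isOpen_ball)
    (fun x _ => mem_iUnion.2 ⟨x, Metric.mem_ball_self (hδ _ (hsub x))⟩)
  have key : ∀ k, R s (σ k) := by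
    intro k
    induction k with
    | zero => rw [h0]; exact hrefl _
    | succ k ih =>
      refine htrans _ _ _ ih ?_
      obtain ⟨x, hx⟩ := hcov k
      have hle : σ k ≤ σ (k + 1) := hmono (Nat.le_succ k)
      have h1 := hx (left_mem_Icc.2 hle)
      have h2 := hx (right_mem_Icc.2 hle)
      rw [Metric.mem_ball, Subtype.dist_eq, Real.dist_eq] at h1 h2
      exact hR x (hsub x) _ _ (hsub _).1 hle (hsub _).2 h1 h2
  have := key m
  rwa [hm m le_rfl] at this

namespace ControlSystem

variable {U : Type*} {n : ℕ} {M : Type*} [TopologicalSpace M]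
  [ChartedSpace (EuclideanSpace ℝ (Fin n)) M] [IsManifold (𝓡 n) ∞ M]
  {S : ControlSystem U n M} {A : Set (ℝ → U)}

/-! ### Concatenation of trajectories -/

theorem SolvesInChart.mono {c : M} {u : ℝ → U} {γ : ℝ → M} {a b a' b' : ℝ}
    (h : S.SolvesInChart c u γ a b) (ha : a ≤ a') (hab : a' ≤ b') (hb : b' ≤ b) :
    S.SolvesInChart c u γ a' b' := by
  obtain ⟨h0, h1, h2, h3, h4⟩ := h
  have hsub : Icc a' b' ⊆ Icc a b := Icc_subset_Icc ha hb
  have hint : ∀ s ∈ Icc a b, ∀ t ∈ Icc a b,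
      IntervalIntegrable (fun r => S.coordV c (u r) (γ r)) volume s t := by
    intro s hs t ht
    refine h3.mono_set ?_
    rw [uIcc_of_le h0]
    exact uIcc_subset_Icc hs ht
  have ha' : a' ∈ Icc a b := hsub (left_mem_Icc.2 hab)
  have haa : a ∈ Icc a b := left_mem_Icc.2 h0
  refine ⟨hab, h1.mono hsub, fun t ht => h2 t (hsub ht),
    hint _ ha' _ (hsub (right_mem_Icc.2 hab)), fun t ht => ?_⟩
  rw [h4 t (hsub ht), h4 a' ha', add_assoc,
    intervalIntegral.integral_add_adjacent_intervals (hint _ haa _ ha') (hint _ ha' _ (hsub ht))]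

theorem SolvesInChart.shift {c : M} {u : ℝ → U} {γ : ℝ → M} {a b : ℝ}
    (h : S.SolvesInChart c u γ a b) (s : ℝ) :
    S.SolvesInChart c (fun t => u (t + s)) (fun t => γ (t + s)) (a - s) (b - s) := by
  obtain ⟨h0, h1, h2, h3, h4⟩ := h
  have hm : ∀ t ∈ Icc (a - s) (b - s), t + s ∈ Icc a b := fun t ht =>
    ⟨by linarith [ht.1], by linarith [ht.2]⟩
  refine ⟨by linarith, h1.comp (by fun_prop) hm, fun t ht => h2 _ (hm t ht),
    h3.comp_add_right s, fun t ht => ?_⟩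
  have := intervalIntegral.integral_comp_add_right (a := a - s) (b := t)
    (fun r => S.coordV c (u r) (γ r)) s
  simp only [sub_add_cancel] at this ⊢
  rw [h4 _ (hm t ht), this]

/-- The value of the control at the end points of the interval is irrelevant. -/
theorem SolvesInChart.congr {c : M} {u v : ℝ → U} {γ δ : ℝ → M} {a b : ℝ}
    (h : S.SolvesInChart c u γ a b) (hu : ∀ t ∈ Ioo a b, v t = u t)
    (hγ : ∀ t ∈ Icc a b, δ t = γ t) :
    S.SolvesInChart c v δ a b := by
  obtain ⟨h0, h1, h2, h3, h4⟩ := h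
  have key : ∀ t ∈ Icc a b, ∀ᵐ r, r ∈ uIoc a t →
      S.coordV c (u r) (γ r) = S.coordV c (v r) (δ r) := by
    intro t ht
    -- the end point `b`, where the controls may differ, is a null set
    filter_upwards [(measure_singleton b : volume {b} = 0) |> compl_mem_ae_iff.2] with r hr hrt
    rw [uIoc_of_le ht.1] at hrt
    have hrb : r < b := lt_of_le_of_ne (hrt.2.trans ht.2) hr
    rw [hu r ⟨hrt.1, hrb⟩, hγ r ⟨hrt.1.le, hrb.le⟩]
  refine ⟨h0, h1.congr hγ, fun t ht => by rw [hγ t ht]; exact h2 t ht, ?_, fun t ht => ?_⟩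
  · refine h3.congr_ae ?_
    rw [Filter.EventuallyEq, ae_restrict_iff' measurableSet_uIoc]
    exact key b (right_mem_Icc.2 h0)
  · rw [hγ t ht, hγ a (left_mem_Icc.2 h0), h4 t ht,
      intervalIntegral.integral_congr_ae (key t ht)]

/-- The trajectory that stays at `p` has length `0`. -/
theorem mem_reachable_self [Nonempty U] (hA : S.IsAdmissibleClass A) (p : M) :
    p ∈ S.reachable A p :=
  ⟨_, hA.const_mem (Classical.arbitrary U), fun _ => p, 0,
    ⟨0, fun _ => 0, fun _ => p, rfl, rfl, by simp⟩, rfl, rfl⟩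

theorem times_le_of_solvesInChart {u : ℝ → U} {γ : ℝ → M} {k : ℕ} {τ : ℕ → ℝ} {c : ℕ → M}
    (h : ∀ i < k, S.SolvesInChart (c i) u γ (τ i) (τ (i + 1))) {i j : ℕ} (hij : i ≤ j)
    (hj : j ≤ k) : τ i ≤ τ j := by
  induction j, hij using Nat.le_induction with
  | base => exact le_rfl
  | succ j _ ih => exact (ih (by omega)).trans (h j (by omega)).1

/-- A trajectory can be prolonged by a solution in a chart. -/
theorem reachable_of_solvesInChart (hA : S.IsAdmissibleClass A) {p : M} {c : M} {v : ℝ → U}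
    (hv : v ∈ A) {δ : ℝ → M} {a b : ℝ} (hδ : S.SolvesInChart c v δ a b)
    (hp : δ a ∈ S.reachable A p) : δ b ∈ S.reachable A p := by
  obtain ⟨u, hu, γ, T, ⟨k, τ, e, h0, hk, hsol⟩, hγ0, hγT⟩ := hp
  have hle : ∀ i ≤ k, τ i ≤ T := fun i hi => hk ▸ times_le_of_solvesInChart hsol hi le_rfl
  have h0T : 0 ≤ T := h0 ▸ hle 0 (Nat.zero_le k)
  have hab := hδ.1
  -- switch at time `T` to the control `v`, shifted so that time `T` becomes time `a`
  refine ⟨_, hA.switch_mem u hu _ (hA.shift_mem v hv a) T,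
    fun t => if t < T then γ t else δ (t - T + a), T + (b - a),
    ⟨k + 1, fun i => if i ≤ k then τ i else T + (b - a), fun i => if i < k then e i else c,
      by simp [h0], by simp, fun i hi => ?_⟩, ?_, ?_⟩
  · rcases Nat.lt_succ_iff_lt_or_eq.1 hi with hi | rfl
    · simp only [hi, hi.le, Nat.succ_le_iff, if_true]
      refine (hsol i hi).congr (fun t ht => ?_) (fun t ht => ?_)
      · rw [if_pos (ht.2.trans_le (hle _ hi))]
      · rcases (ht.2.trans (hle _ hi)).lt_or_eq with h | rfl
        · rw [if_pos h]
        · simp [hγT]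
    · have := hδ.shift (a - T)
      rw [show a - (a - T) = T by ring, show b - (a - T) = T + (b - a) by ring] at this
      simp only [le_refl, if_true, lt_irrefl, if_false, Nat.succ_le_iff, hk]
      refine this.congr (fun t ht => ?_) (fun t ht => ?_)
      · rw [if_neg (not_lt.2 ht.1.le)]
        congr 1; ring
      · simp only [if_neg (not_lt.2 ht.1)]
        congr 1; ring
  · rcases h0T.lt_or_eq with h | h
    · simp only [if_pos h, hγ0]
    · simp [← h, ← hγ0, ← hγT]
  · simp [hab]

theorem reachable_trans (hA : S.IsAdmissibleClass A) {x y z : M}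
    (hxy : y ∈ S.reachable A x) (hyz : z ∈ S.reachable A y) : z ∈ S.reachable A x := by
  obtain ⟨u, hu, γ, T, ⟨k, τ, e, h0, hk, hsol⟩, rfl, rfl⟩ := hyz
  have key : ∀ j ≤ k, γ (τ j) ∈ S.reachable A x := by
    intro j
    induction j with
    | zero => intro _; rwa [h0]
    | succ j ih => intro hj; exact reachable_of_solvesInChart hA hu (hsol j hj) (ih (by omega))
  exact hk ▸ key k le_rfl

/-! ### Vector fields in coordinates -/

/-- The vector field `X` written in the coordinates of the chart at `c`. -/
noncomputable def fieldCoord (c : M) (X : (x : M) → TangentSpace (𝓡 n) x) (x : M) :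
    EuclideanSpace ℝ (Fin n) :=
  tangentCoordChange (𝓡 n) x c x (X x)

theorem contMDiffOn_fieldCoord {X : (x : M) → TangentSpace (𝓡 n) x}
    (hX : ContMDiff (𝓡 n) (𝓡 n).tangent ∞ (fun x => (⟨x, X x⟩ : TangentBundle (𝓡 n) M))) (c : M) :
    ContMDiffOn (𝓡 n) 𝓘(ℝ, EuclideanSpace ℝ (Fin n)) ∞ (fieldCoord c X)
      (chartAt (EuclideanSpace ℝ (Fin n)) c).source := by
  have : IsManifold (𝓡 n) (∞ + 1) M := ‹IsManifold (𝓡 n) ∞ M›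
  exact ((trivializationAt (EuclideanSpace ℝ (Fin n)) (TangentSpace (𝓡 n) (M := M))
    c).contMDiffOn_section_baseSet_iff (IB := 𝓡 n) (n := ∞)).1 hX.contMDiffOn

theorem hasDerivAt_chart_flow (u : U) (c x : M) {t : ℝ}
    (ht : S.flow u t x ∈ (chartAt (EuclideanSpace ℝ (Fin n)) c).source) :
    HasDerivAt (fun s => chartAt (EuclideanSpace ℝ (Fin n)) c (S.flow u s x))
      (S.coordV c u (S.flow u t x)) t := by
  have h1 := (hasMFDerivAt_extChartAt (I := 𝓡 n) ht).comp t (S.integralCurve_flow u x t)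
  have h2 : HasFDerivAt (fun s => chartAt (EuclideanSpace ℝ (Fin n)) c (S.flow u s x))
      ((tangentCoordChange (𝓡 n) (S.flow u t x) c (S.flow u t x)).comp
        ((1 : ℝ →L[ℝ] ℝ).smulRight (S.V u (S.flow u t x) : EuclideanSpace ℝ (Fin n)))) t := by
    rw [← mfderiv_chartAt_eq_tangentCoordChange ht]
    exact hasMFDerivAt_iff_hasFDerivAt.1 h1
  refine h2.hasDerivAt.congr_deriv ?_
  exact congrArg (tangentCoordChange (𝓡 n) (S.flow u t x) c (S.flow u t x))
    (one_smul ℝ (S.V u (S.flow u t x) : EuclideanSpace ℝ (Fin n)))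

theorem continuous_flow_curve (u : U) (x : M) : Continuous fun t => S.flow u t x :=
  continuous_iff_continuousAt.2 fun t => (S.integralCurve_flow u x t).continuousAt

/-- Orbits of the flows are trajectories for constant controls. -/
theorem flow_solvesInChart (u : U) (c x : M) {a b : ℝ} (hab : a ≤ b)
    (h : ∀ t ∈ Icc a b, S.flow u t x ∈ (chartAt (EuclideanSpace ℝ (Fin n)) c).source) :
    S.SolvesInChart c (fun _ => u) (fun t => S.flow u t x) a b := by
  have hcont : ContinuousOn (fun r => S.coordV c u (S.flow u r x)) (Icc a b) :=
    ((contMDiffOn_fieldCoord (S.smooth_V u) c).continuousOn).comp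
      (continuous_flow_curve u x).continuousOn h
  have hint : ∀ t ∈ Icc a b,
      IntervalIntegrable (fun r => S.coordV c u (S.flow u r x)) volume a t := fun t ht =>
    (hcont.mono (by rw [uIcc_of_le ht.1]; exact Icc_subset_Icc_right ht.2)).intervalIntegrable
  refine ⟨hab, (continuous_flow_curve u x).continuousOn, h, hint b (right_mem_Icc.2 hab),
    fun t ht => ?_⟩
  rw [intervalIntegral.integral_eq_sub_of_hasDerivAt (fun r hr => hasDerivAt_chart_flow u c x
    (h r ?_)) (hint t ht)]
  · simp
  · rw [uIcc_of_le ht.1] at hr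
    exact ⟨hr.1, hr.2.trans ht.2⟩

theorem flow_mem_reachable (hA : S.IsAdmissibleClass A) [Nonempty U] (u : U) (x : M) {t : ℝ}
    (ht : 0 ≤ t) : S.flow u t x ∈ S.reachable A x := by
  have := rel_of_local_of_le
    (R := fun r s => S.flow u s x ∈ S.reachable A (S.flow u r x)) (a := 0) (b := t)
    (fun _ => mem_reachable_self hA _) (fun r s t h1 h2 => reachable_trans hA h1 h2) ?_
    le_rfl ht le_rfl
  · simpa [S.flow_zero] using this
  · intro τ _
    set φ := chartAt (EuclideanSpace ℝ (Fin n)) (S.flow u τ x)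
    have : (fun t => S.flow u t x) ⁻¹' φ.source ∈ 𝓝 τ :=
      (continuous_flow_curve u x).continuousAt.preimage_mem_nhds
        (φ.open_source.mem_nhds (mem_chart_source _ _))
    obtain ⟨δ, hδ, hsub⟩ := Metric.mem_nhds_iff.1 this
    refine ⟨δ, hδ, fun s r _ hsr _ h1 h2 => ?_⟩
    refine reachable_of_solvesInChart hA (hA.const_mem u)
      (flow_solvesInChart u (S.flow u τ x) x hsr fun y hy => hsub ?_) (mem_reachable_self hA _)
    rw [abs_lt] at h1 h2
    rw [Metric.mem_ball, Real.dist_eq, abs_lt]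
    exact ⟨by linarith [hy.1], by linarith [hy.2]⟩

end ControlSystem

/-! ### Carathéodory differential equations -/

/-- A function that is measurable in `t` and continuous in `y` stays measurable in `t` when a
measurable function of `t` is substituted for `y`: approximate the latter by simple functions. -/
theorem aestronglyMeasurable_comp_of_continuousOn {α E F : Type*} [MeasurableSpace α]
    {μ : Measure α} [PseudoEMetricSpace E] [SecondCountableTopology E] [MeasurableSpace E]
    [BorelSpace E] [NormedAddCommGroup F] {K : Set E} {f : α → E → F}
    {η : α → E} (hmeas : ∀ y ∈ K, AEStronglyMeasurable (fun t => f t y) μ)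
    (hcont : ∀ᵐ t ∂μ, ContinuousOn (f t) K) (hη : Measurable η) (hK : ∀ t, η t ∈ K) :
    AEStronglyMeasurable (fun t => f t (η t)) μ := by
  rcases isEmpty_or_nonempty α with h | ⟨⟨t₀⟩⟩
  · rw [Measure.eq_zero_of_isEmpty μ]
    exact aestronglyMeasurable_zero_measure _
  set φ := SimpleFunc.approxOn η hη K (η t₀) (hK t₀)
  refine aestronglyMeasurable_of_tendsto_ae Filter.atTop (f := fun k t => f t (φ k t)) (fun k => ?_)
    ?_
  · have : (fun t => f t (φ k t)) =
        fun t => ∑ y ∈ (φ k).range, (φ k ⁻¹' {y}).indicator (fun t => f t y) t := by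
      ext t
      rw [Finset.sum_eq_single_of_mem (φ k t) (SimpleFunc.mem_range_self _ _)]
      · simp
      · intro y _ hy
        exact indicator_of_notMem (fun h => hy h.symm) _
    rw [this]
    refine Finset.aestronglyMeasurable_fun_sum _ fun y hy => ?_
    obtain ⟨t, rfl⟩ := SimpleFunc.mem_range.1 hy
    exact (hmeas _ (SimpleFunc.approxOn_mem hη (hK t₀) k t)).indicator
      ((φ k).measurableSet_fiber _)
  · filter_upwards [hcont] with t ht
    refine ((ht (η t) (hK t)).tendsto).comp (tendsto_nhdsWithin_iff.2
      ⟨SimpleFunc.tendsto_approxOn hη (hK t₀) (subset_closure (hK t)), .of_forall fun k =>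
        SimpleFunc.approxOn_mem hη (hK t₀) k t⟩)

/-- Continuous dependence on the initial value for Carathéodory differential equations: around a
solution `γ` on an interval so short that the Lipschitz constants have integral at most `1 / 2`,
solutions with nearby initial values exist on the whole interval and stay near `γ`. They are the
fixed points of the Picard operator, a contraction with constant `1 / 2`. -/
theorem exists_caratheodory_solution_near {E : Type*} [NormedAddCommGroup E] [NormedSpace ℝ E]
    [CompleteSpace E] [SecondCountableTopology E] {f : ℝ → E → E} {γ : ℝ → E} {m : ℝ → ℝ}
    {K : Set E} {a b ρ : ℝ} (hab : a ≤ b) (hγ : ContinuousOn γ (Icc a b))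
    (hK : ∀ t ∈ Icc a b, Metric.closedBall (γ t) ρ ⊆ K) (hm : IntervalIntegrable m volume a b)
    (hm2 : ∫ r in a..b, m r ≤ 1 / 2)
    (hmeas : ∀ y ∈ K, AEStronglyMeasurable (fun t => f t y) (volume.restrict (Ioc a b)))
    (hlip : ∀ᵐ t ∂(volume.restrict (Ioc a b)),
      0 ≤ m t ∧ ∀ y ∈ K, ∀ z ∈ K, ‖f t y - f t z‖ ≤ m t * ‖y - z‖)
    (hfγ : IntervalIntegrable (fun r => f r (γ r)) volume a b)
    (hsol : ∀ t ∈ Icc a b, γ t = γ a + ∫ r in a..t, f r (γ r)) {y₀ : E}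
    (hy₀ : 2 * ‖y₀ - γ a‖ ≤ ρ) :
    ∃ η : ℝ → E, ContinuousOn η (Icc a b) ∧ η a = y₀ ∧
      (∀ t ∈ Icc a b, ‖η t - γ t‖ ≤ 2 * ‖y₀ - γ a‖) ∧
      IntervalIntegrable (fun r => f r (η r)) volume a b ∧
      ∀ t ∈ Icc a b, η t = y₀ + ∫ r in a..t, f r (η r) := by
  borelize E
  set R := 2 * ‖y₀ - γ a‖
  have hR : 0 ≤ R := by positivity
  have hγK : ∀ t ∈ Icc a b, γ t ∈ K := fun t ht =>
    hK t ht (Metric.mem_closedBall_self (hR.trans hy₀))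
  have hsub : ∀ t ∈ Icc a b, uIcc a t ⊆ uIcc a b := fun t ht => by
    rw [uIcc_of_le ht.1, uIcc_of_le hab]; exact Icc_subset_Icc_right ht.2
  -- the Lipschitz estimate for the integral operator
  have hest : ∀ (η ξ : ℝ → E) (D : ℝ), (∀ t ∈ Icc a b, η t ∈ K) → (∀ t ∈ Icc a b, ξ t ∈ K) →
      (∀ t ∈ Icc a b, ‖η t - ξ t‖ ≤ D) → IntervalIntegrable (fun r => f r (η r)) volume a b →
      IntervalIntegrable (fun r => f r (ξ r)) volume a b → ∀ t ∈ Icc a b,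
      ‖(∫ r in a..t, f r (η r)) - ∫ r in a..t, f r (ξ r)‖ ≤ D / 2 := by
    intro η ξ D hη hξ hD hiη hiξ t ht
    have hD0 : 0 ≤ D := (norm_nonneg _).trans (hD t ht)
    rw [← intervalIntegral.integral_sub (hiη.mono_set (hsub t ht)) (hiξ.mono_set (hsub t ht))]
    have hlip' := (ae_restrict_iff' measurableSet_Ioc).1 hlip
    calc ‖∫ r in a..t, f r (η r) - f r (ξ r)‖ ≤ ∫ r in a..t, m r * D := by
          refine intervalIntegral.norm_integral_le_of_norm_le ht.1 ?_
            ((hm.mono_set (hsub t ht)).mul_const D)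
          filter_upwards [hlip'] with r hr hrt
          have hr' : r ∈ Ioc a b := ⟨hrt.1, hrt.2.trans ht.2⟩
          have hr'' := Ioc_subset_Icc_self hr'
          obtain ⟨h0, h1⟩ := hr hr'
          exact (h1 _ (hη r hr'') _ (hξ r hr'')).trans
            (mul_le_mul_of_nonneg_left (hD r hr'') h0)
      _ = (∫ r in a..t, m r) * D := by rw [intervalIntegral.integral_mul_const]
      _ ≤ (∫ r in a..b, m r) * D := by
          refine mul_le_mul_of_nonneg_right ?_ hD0
          refine intervalIntegral.integral_mono_interval le_rfl ht.1 ht.2 ?_ hm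
          filter_upwards [hlip] with r hr using hr.1
      _ ≤ D / 2 := by nlinarith
  have hcontf : ∀ᵐ t ∂(volume.restrict (Ioc a b)), ContinuousOn (f t) K := by
    filter_upwards [hlip] with t ⟨h0, h1⟩
    refine (LipschitzOnWith.of_dist_le_mul (K := ⟨m t, h0⟩) fun y hy z hz => ?_).continuousOn
    rw [dist_eq_norm, dist_eq_norm]
    exact h1 y hy z hz
  set γC : C(Icc a b, E) := ⟨fun t => γ t, continuousOn_iff_continuous_domRestrict.1 hγ⟩
  -- the Picard operator `Ψ` acts on the curves at distance at most `R` from `γ`; they are extended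
  -- to all times as constants outside `[a, b]`
  let X := Metric.closedBall γC R
  have hX : ∀ (η : X) (t : Icc a b), ‖η.1 t - γ t‖ ≤ R := fun η t => by
    have := (ContinuousMap.dist_le hR).1 (Metric.mem_closedBall.1 η.2) t
    rwa [dist_eq_norm] at this
  let ext : C(Icc a b, E) → ℝ → E := fun η r => η (projIcc a b hab r)
  have hext : ∀ (η : C(Icc a b, E)) (t : Icc a b), ext η t = η t := fun η t => by
    simp only [ext, projIcc_val]
  have hextK : ∀ (η : X) (t : ℝ), ext η.1 t ∈ K := fun η t =>
    hK _ (projIcc a b hab t).2 (Metric.mem_closedBall.2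
      (by rw [dist_eq_norm]; exact (hX η _).trans hy₀))
  have hextint : ∀ η : X, IntervalIntegrable (fun r => f r (ext η.1 r)) volume a b := by
    intro η
    refine (hfγ.norm.add (hm.mul_const R)).mono_fun' ?_ ?_
    · rw [uIoc_of_le hab]
      refine aestronglyMeasurable_comp_of_continuousOn (K := K) hmeas hcontf
        (Continuous.measurable ?_) (hextK η)
      exact η.1.continuous.comp continuous_projIcc
    · rw [uIoc_of_le hab]
      filter_upwards [hlip, ae_restrict_mem measurableSet_Ioc] with r ⟨h0, h1⟩ hr
      have hr' := Ioc_subset_Icc_self hr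
      have h2 := h1 _ (hextK η r) _ (hγK r hr')
      have h3 : ‖ext η.1 r - γ r‖ ≤ R := by
        have := hX η ⟨r, hr'⟩
        rwa [← hext] at this
      have h4 := norm_le_norm_add_norm_sub (f r (γ r)) (f r (ext η.1 r))
      have h5 := mul_le_mul_of_nonneg_left h3 h0
      rw [norm_sub_rev] at h4
      linarith
  -- `γ` itself is displaced by `Ψ` by `‖y₀ - γ a‖ = R / 2` only
  have hγ2 : ∀ t ∈ Icc a b, y₀ + (∫ r in a..t, f r (γ r)) - γ t = y₀ - γ a := fun t ht => by
    rw [hsol t ht]; abel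
  let Ψ : X → X := fun η => ⟨⟨fun t => y₀ + ∫ r in a..t, f r (ext η.1 r), by
    have h := intervalIntegral.continuousOn_primitive_interval
      ((intervalIntegrable_iff').1 (hextint η))
    rw [uIcc_of_le hab] at h
    exact continuous_const.add (continuousOn_iff_continuous_domRestrict.1 h)⟩, by
    refine Metric.mem_closedBall.2 ((ContinuousMap.dist_le hR).2 fun t => ?_)
    rw [dist_eq_norm]
    have h1 := hest (ext η.1) γ R (fun t _ => hextK η t) hγK
      (fun t ht => by rw [hext η.1 ⟨t, ht⟩]; exact hX η ⟨t, ht⟩) (hextint η) hfγ t t.2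
    have h2 := norm_add_le ((∫ r in a..t, f r (ext η.1 r)) - ∫ r in a..t, f r (γ r)) (y₀ - γ a)
    rw [← hγ2 t t.2] at h2
    have h3 : (∫ r in a..(t : ℝ), f r (ext η.1 r)) - (∫ r in a..(t : ℝ), f r (γ r)) +
      (y₀ + (∫ r in a..(t : ℝ), f r (γ r)) - γ t) =
      y₀ + (∫ r in a..(t : ℝ), f r (ext η.1 r)) - γ t := by abel
    rw [h3, hγ2 t t.2] at h2
    refine h2.trans ?_
    have : R / 2 = ‖y₀ - γ a‖ := by simp only [R]; ring
    linarith⟩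
  have hΨ : ContractingWith (1 / 2) Ψ := by
    refine ⟨by norm_num, LipschitzWith.of_dist_le_mul fun η ξ => ?_⟩
    rw [Subtype.dist_eq]
    refine (ContinuousMap.dist_le (by positivity)).2 fun t => ?_
    rw [dist_eq_norm]
    have h1 := hest (ext η.1) (ext ξ.1) (dist η ξ) (fun t _ => hextK η t) (fun t _ => hextK ξ t)
      (fun t ht => by
        rw [hext η.1 ⟨t, ht⟩, hext ξ.1 ⟨t, ht⟩, ← dist_eq_norm]
        exact ContinuousMap.dist_apply_le_dist _) (hextint η) (hextint ξ) t t.2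
    have h2 : (Ψ η).1 t - (Ψ ξ).1 t =
        (∫ r in a..(t : ℝ), f r (ext η.1 r)) - ∫ r in a..(t : ℝ), f r (ext ξ.1 r) :=
      add_sub_add_left_eq_sub _ _ _
    rw [h2]
    refine h1.trans (le_of_eq ?_)
    push_cast
    ring
  have : CompleteSpace X := Metric.isClosed_closedBall.completeSpace_coe
  have : Nonempty X := ⟨⟨γC, Metric.mem_closedBall_self hR⟩⟩
  obtain ⟨η, hη⟩ : ∃ η, Ψ η = η := ⟨_, hΨ.fixedPoint_isFixedPt⟩
  have hηt : ∀ t ∈ Icc a b, ext η.1 t = y₀ + ∫ r in a..t, f r (ext η.1 r) := fun t ht => by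
    rw [hext η.1 ⟨t, ht⟩]
    conv_lhs => rw [← hη]
    rfl
  refine ⟨ext η.1, (η.1.continuous.comp continuous_projIcc).continuousOn, ?_, fun t ht => ?_,
    hextint η, hηt⟩
  · rw [hηt a (left_mem_Icc.2 hab), intervalIntegral.integral_same, add_zero]
  · rw [hext η.1 ⟨t, ht⟩]
    exact hX η ⟨t, ht⟩

/-! ### Backward propagation along trajectories -/

namespace ControlSystem

variable {U : Type*} {n : ℕ} {M : Type*} [TopologicalSpace M]
  [ChartedSpace (EuclideanSpace ℝ (Fin n)) M] [IsManifold (𝓡 n) ∞ M]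
  {S : ControlSystem U n M} {A : Set (ℝ → U)}

/-- If `B` contains every point from which it can be reached, its interior propagates backwards
along a solution in a chart: solutions that start near `γ s` follow `γ` into the interior. -/
theorem SolvesInChart.mem_interior_of_le [Nonempty U] (hA : S.IsAdmissibleClass A) {B : Set M}
    (hB : ∀ x, ∀ y ∈ B, y ∈ S.reachable A x → x ∈ B) {u : ℝ → U} (hu : u ∈ A) {c : M}
    {γ : ℝ → M} {a b : ℝ} (h : S.SolvesInChart c u γ a b) {s t : ℝ} (has : a ≤ s) (hst : s ≤ t)
    (htb : t ≤ b) (ht : γ t ∈ interior B) : γ s ∈ interior B := by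
  refine rel_of_local_of_le (R := fun s t => γ t ∈ interior B → γ s ∈ interior B) (fun _ h => h)
    (fun r s t h1 h2 h3 => h1 (h2 h3)) ?_ has hst htb ht
  clear ht has hst htb s t
  intro τ hτ
  set φ := chartAt (EuclideanSpace ℝ (Fin n)) c with hφ
  have hab := h.1
  have hsrc := h.2.2.1
  obtain ⟨K, hK, m, hm, hmeas, hlip⟩ := hA.locallyIntegrable u hu c (γ τ) (hsrc τ hτ) a b hab
  obtain ⟨ρ₂, hρ₂, hball⟩ := Metric.nhds_basis_closedBall.mem_iff.1
    (Filter.inter_mem hK (φ.open_target.mem_nhds (φ.map_source (hsrc τ hτ))))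
  obtain ⟨ρ, rfl⟩ : ∃ ρ, ρ₂ = 2 * ρ := ⟨ρ₂ / 2, by ring⟩
  have hρ : 0 < ρ := by linarith
  have hγc : ContinuousOn (fun t => φ (γ t)) (Icc a b) := φ.continuousOn.comp h.2.1 hsrc
  have hFc : ContinuousOn (fun t => ∫ r in a..t, m r) (Icc a b) := by
    have := intervalIntegral.continuousOn_primitive_interval ((intervalIntegrable_iff').1 hm)
    rwa [uIcc_of_le hab] at this
  -- near `τ` the curve moves by less than `ρ` and the Lipschitz constants have integral `≤ 1 / 2`
  obtain ⟨δ₁, hδ₁, h1⟩ := Metric.continuousOn_iff.1 hγc τ hτ ρ hρ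
  obtain ⟨δ₂, hδ₂, h2⟩ := Metric.continuousOn_iff.1 hFc τ hτ (1 / 4) (by norm_num)
  refine ⟨min δ₁ δ₂, lt_min hδ₁ hδ₂, fun s t has hst htb hs ht hγt => ?_⟩
  have hsub : Icc s t ⊆ Icc a b := Icc_subset_Icc has htb
  have hsI : s ∈ Icc a b := hsub (left_mem_Icc.2 hst)
  have htI : t ∈ Icc a b := hsub (right_mem_Icc.2 hst)
  have hmint : ∀ x ∈ Icc a b, ∀ y ∈ Icc a b, IntervalIntegrable m volume x y := fun x hx y hy =>
    hm.mono_set (by rw [uIcc_of_le hab]; exact uIcc_subset_Icc hx hy)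
  have haI : a ∈ Icc a b := left_mem_Icc.2 hab
  have hm2 : ∫ r in s..t, m r ≤ 1 / 2 := by
    have e1 := h2 s hsI (hs.trans_le (min_le_right _ _))
    have e2 := h2 t htI (ht.trans_le (min_le_right _ _))
    rw [Real.dist_eq, abs_lt] at e1 e2
    have := intervalIntegral.integral_add_adjacent_intervals (hmint a haI s hsI)
      (hmint s hsI t htI)
    linarith [e1.1, e2.2]
  have hnear : ∀ r ∈ Icc s t, dist (φ (γ r)) (φ (γ τ)) < ρ := fun r hr => by
    refine h1 r (hsub hr) (lt_of_lt_of_le ?_ (min_le_left _ δ₂))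
    rw [Real.dist_eq, abs_lt]
    rw [abs_lt] at hs ht
    exact ⟨by linarith [hr.1], by linarith [hr.2]⟩
  -- a radius for which curves near `γ` stay in the chart and end in the interior of `B`
  have htsrc := hsrc t htI
  have hopen : φ.symm ⁻¹' interior B ∈ 𝓝 (φ (γ t)) :=
    (φ.symm.continuousAt (φ.map_source htsrc)).preimage_mem_nhds (by
      rw [φ.left_inv htsrc]; exact isOpen_interior.mem_nhds hγt)
  obtain ⟨ε₀, hε₀, hε₀B⟩ := Metric.nhds_basis_closedBall.mem_iff.1 hopen
  set ε := min ε₀ ρ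
  have hε : 0 < ε := lt_min hε₀ hρ
  have hballK : ∀ r ∈ Icc s t, Metric.closedBall (φ (γ r)) ε ⊆
      Metric.closedBall (φ (γ τ)) (2 * ρ) := fun r hr => by
    refine Metric.closedBall_subset_closedBall' ?_
    have := hnear r hr
    have := min_le_right ε₀ ρ
    linarith
  have hIoc : Ioc s t ⊆ Ioc a b := Ioc_subset_Ioc has htb
  have hcτ : φ (γ τ) ∈ K := mem_of_mem_nhds hK
  have hKK : Metric.closedBall (φ (γ τ)) (2 * ρ) ⊆ K := fun y hy => (hball hy).1
  obtain ⟨-, -, -, hfint, hsolve⟩ := h.mono has hst htb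
  have hleft : ∀ r ∈ Icc a b, φ.symm (φ (γ r)) = γ r := fun r hr => φ.left_inv (hsrc r hr)
  have hcongr : ∀ r ∈ Icc a b, S.coordV c (u r) (φ.symm (φ (γ r))) = S.coordV c (u r) (γ r) :=
    fun r hr => by rw [hleft r hr]
  have hlip' : ∀ᵐ r ∂(volume.restrict (Ioc s t)), 0 ≤ m r ∧
      ∀ y ∈ Metric.closedBall (φ (γ τ)) (2 * ρ), ∀ z ∈ Metric.closedBall (φ (γ τ)) (2 * ρ),
        ‖S.coordV c (u r) (φ.symm y) - S.coordV c (u r) (φ.symm z)‖ ≤ m r * ‖y - z‖ := by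
    filter_upwards [ae_mono (Measure.restrict_mono hIoc le_rfl) hlip] with r hr
    exact ⟨(norm_nonneg _).trans (hr.1 _ hcτ), fun y hy z hz => hr.2 y (hKK hy) z (hKK hz)⟩
  have hfint' : IntervalIntegrable (fun r => S.coordV c (u r) (φ.symm (φ (γ r)))) volume s t := by
    refine IntervalIntegrable.congr (fun r hr => ?_) hfint
    rw [uIoc_of_le hst] at hr
    exact (hcongr r (hsub (Ioc_subset_Icc_self hr))).symm
  have hsolve' : ∀ r ∈ Icc s t, φ (γ r) =
      φ (γ s) + ∫ r in s..r, S.coordV c (u r) (φ.symm (φ (γ r))) := by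
    intro r hr
    rw [hsolve r hr]
    congr 1
    refine intervalIntegral.integral_congr fun r' hr' => ?_
    rw [uIcc_of_le hr.1] at hr'
    exact (hcongr r' (hsub ⟨hr'.1, hr'.2.trans hr.2⟩)).symm
  have hmain : ∀ y₀, 2 * ‖y₀ - φ (γ s)‖ ≤ ε → φ.symm y₀ ∈ B := by
    intro y₀ hy₀
    obtain ⟨η, hη, hηs, hηγ, hηint, hηsol⟩ := exists_caratheodory_solution_near
      (f := fun r y => S.coordV c (u r) (φ.symm y)) (γ := fun r => φ (γ r)) (m := m)
      (K := Metric.closedBall (φ (γ τ)) (2 * ρ)) (ρ := ε) hst (hγc.mono hsub) hballK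
      (hmint s hsI t htI) hm2
      (fun y hy => (hmeas y (hKK hy)).mono_measure (Measure.restrict_mono hIoc le_rfl))
      hlip' hfint' hsolve' hy₀
    have hηmem : ∀ r ∈ Icc s t, η r ∈ Metric.closedBall (φ (γ r)) ε := fun r hr => by
      rw [Metric.mem_closedBall, dist_eq_norm]
      exact (hηγ r hr).trans hy₀
    have hηtgt : ∀ r ∈ Icc s t, η r ∈ φ.target := fun r hr =>
      (hball (hballK r hr (hηmem r hr))).2
    have hsolη : S.SolvesInChart c u (fun r => φ.symm (η r)) s t := by
      refine ⟨hst, φ.symm.continuousOn.comp hη hηtgt, fun r hr => φ.map_target (hηtgt r hr),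
        hηint, fun r hr => ?_⟩
      rw [← hφ, φ.right_inv (hηtgt r hr), φ.right_inv (hηtgt s (left_mem_Icc.2 hst)), hηs]
      exact hηsol r hr
    have hend : φ.symm (η t) ∈ interior B := hε₀B (Metric.closedBall_subset_closedBall
      (min_le_left _ _) (hηmem t (right_mem_Icc.2 hst)))
    have := reachable_of_solvesInChart hA hu hsolη (mem_reachable_self hA _)
    simp only [hηs] at this
    exact hB _ _ (interior_subset hend) this
  have hssrc := hsrc s hsI
  refine mem_interior_iff_mem_nhds.2 ?_
  filter_upwards [φ.open_source.mem_nhds hssrc, (φ.continuousAt hssrc).preimage_mem_nhds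
    (Metric.ball_mem_nhds _ (half_pos hε))] with x hx1 hx2
  rw [← φ.left_inv hx1]
  refine hmain _ ?_
  rw [mem_preimage, Metric.mem_ball, dist_eq_norm] at hx2
  linarith

theorem IsTrajectory.mem_interior_of_le [Nonempty U] (hA : S.IsAdmissibleClass A) {B : Set M}
    (hB : ∀ x, ∀ y ∈ B, y ∈ S.reachable A x → x ∈ B) {u : ℝ → U} (hu : u ∈ A)
    {γ : ℝ → M} {T : ℝ} (h : S.IsTrajectory u γ T) {s t : ℝ} (hs : 0 ≤ s) (hst : s ≤ t)
    (htT : t ≤ T) (ht : γ t ∈ interior B) : γ s ∈ interior B := by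
  obtain ⟨k, τ, c, h0, hk, hsol⟩ := h
  have key : ∀ j ≤ k, ∀ s t, 0 ≤ s → s ≤ t → t ≤ τ j → γ t ∈ interior B → γ s ∈ interior B := by
    intro j
    induction j with
    | zero =>
      intro _ s t h1 h2 h3 h4
      rwa [show s = t by linarith]
    | succ j ih =>
      intro hj s t h1 h2 h3 h4
      rcases le_total t (τ j) with h5 | h5
      · exact ih (by omega) s t h1 h2 h5 h4
      rcases le_total s (τ j) with h6 | h6
      · exact ih (by omega) s (τ j) h1 h6 le_rfl
          ((hsol j hj).mem_interior_of_le hA hB hu le_rfl h5 h3 h4)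
      · exact (hsol j hj).mem_interior_of_le hA hB hu h6 h2 h3 h4
  exact key k le_rfl s t hs hst (hk ▸ htT) ht

end ControlSystem

/-! ### Derivatives along flows -/

/-- Surjectivity of continuous linear maps onto a finite-dimensional space is an open condition:
a right inverse of one map becomes invertible after composition with a nearby map. -/
theorem ContinuousLinearMap.eventually_surjective {E F : Type*} [NormedAddCommGroup E]
    [NormedSpace ℝ E] [FiniteDimensional ℝ E] [NormedAddCommGroup F] [NormedSpace ℝ F]
    {L : F →L[ℝ] E} (hL : Function.Surjective L) :
    ∀ᶠ L' in 𝓝 L, Function.Surjective (L' : F →L[ℝ] E) := by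
  have : CompleteSpace E := FiniteDimensional.complete ℝ E
  obtain ⟨B, hB⟩ := LinearMap.exists_rightInverse_of_surjective L.toLinearMap
    (LinearMap.range_eq_top.2 hL)
  set B' : E →L[ℝ] F := LinearMap.toContinuousLinearMap B
  have hcont : Continuous fun L' : F →L[ℝ] E => L'.comp B' := by fun_prop
  have h0 : L.comp B' = (ContinuousLinearEquiv.refl ℝ E : E →L[ℝ] E) := by
    ext x; exact LinearMap.congr_fun hB x
  have := hcont.continuousAt.preimage_mem_nhds (h0 ▸ (ContinuousLinearEquiv.refl ℝ E).nhds)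
  filter_upwards [this] with L' ⟨e, he⟩ x
  obtain ⟨y, rfl⟩ := e.surjective x
  exact ⟨B' y, (DFunLike.congr_fun he y).symm⟩

/-- Let `Φ` be a local flow with velocity field `V` and `X` a vector field whose pull-backs
`(D Φ_r)⁻¹ X(Φ_r)` at `y` lie in a subspace `F` for small `r < 0`. Then so do the limit `X y` of these
pull-backs and their derivative at `r = 0`, the Lie bracket of `V` and `X` at `y`. -/
theorem mem_and_lieBracket_mem_of_flow {E : Type*} [NormedAddCommGroup E] [NormedSpace ℝ E]
    [FiniteDimensional ℝ E] {Φ : ℝ × E → E} {V X : E → E} {y : E} (F : Submodule ℝ E)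
    (hΦ : ContDiffAt ℝ 2 Φ (0, y)) (hΦ0 : ∀ᶠ z in 𝓝 y, Φ (0, z) = z)
    (hV : ∀ᶠ z in 𝓝 y, HasDerivAt (fun r => Φ (r, z)) (V z) 0) (hX : DifferentiableAt ℝ X y)
    (hF : ∀ᶠ r in 𝓝[<] (0 : ℝ),
      X (Φ (r, y)) ∈ F.map (fderiv ℝ (fun z => Φ (r, z)) y : E →ₗ[ℝ] E)) :
    X y ∈ F ∧ VectorField.lieBracket ℝ V X y ∈ F := by
  have : CompleteSpace E := FiniteDimensional.complete ℝ E
  have hdiff : ∀ᶠ p in 𝓝 ((0 : ℝ), y), DifferentiableAt ℝ Φ p := by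
    filter_upwards [hΦ.eventually (by simp)] with p hp
    exact hp.differentiableAt (by simp)
  set A : ℝ → E →L[ℝ] E := fun r => (fderiv ℝ Φ (r, y)).comp (ContinuousLinearMap.inr ℝ ℝ E)
  have hcr : ContinuousAt (fun r : ℝ => (r, y)) 0 := by fun_prop
  have hcz : ContinuousAt (fun z : E => ((0 : ℝ), z)) y := by fun_prop
  have hA : ∀ᶠ r in 𝓝 (0 : ℝ), fderiv ℝ (fun z => Φ (r, z)) y = A r := by
    filter_upwards [hcr.eventually hdiff] with r hr
    exact (hr.hasFDerivAt.comp y (hasFDerivAt_prodMk_right r y)).fderiv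
  have hA0 : A 0 = 1 := by
    rw [← hA.self_of_nhds, Filter.EventuallyEq.fderiv_eq (f := id) hΦ0]
    exact fderiv_id
  -- the second derivative of the flow
  have hD : DifferentiableAt ℝ (fderiv ℝ Φ) (0, y) :=
    (hΦ.fderiv_right (m := 1) (by norm_num)).differentiableAt (by simp)
  set D₂ := fderiv ℝ (fderiv ℝ Φ) (0, y)
  have hAd : HasDerivAt A ((D₂ (1, 0)).comp (ContinuousLinearMap.inr ℝ ℝ E)) 0 := by
    have h1 : HasDerivAt (fun r : ℝ => fderiv ℝ Φ (r, y)) (D₂ (1, 0)) 0 :=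
      hD.hasFDerivAt.comp_hasDerivAt (0 : ℝ) ((hasDerivAt_id _).prodMk (hasDerivAt_const _ _))
    exact (((ContinuousLinearMap.compL ℝ E (ℝ × E) E).flip
      (ContinuousLinearMap.inr ℝ ℝ E)).hasFDerivAt.comp_hasDerivAt _ h1)
  have hVd : HasFDerivAt V ((D₂.comp (ContinuousLinearMap.inr ℝ ℝ E)).flip (1, 0)) y := by
    have h1 : HasFDerivAt (fun z : E => fderiv ℝ Φ (0, z))
        (D₂.comp (ContinuousLinearMap.inr ℝ ℝ E)) y :=
      hD.hasFDerivAt.comp y (hasFDerivAt_prodMk_right 0 y)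
    have h2 := h1.clm_apply (hasFDerivAt_const ((1 : ℝ), (0 : E)) y)
    simp only [ContinuousLinearMap.comp_zero, zero_add] at h2
    refine h2.congr_of_eventuallyEq ?_
    filter_upwards [hV, hcz.eventually hdiff] with z hz hz'
    exact hz.unique (hz'.hasFDerivAt.comp_hasDerivAt (0 : ℝ)
      ((hasDerivAt_id _).prodMk (hasDerivAt_const _ _)))
  -- `∂_r D_z Φ = D_z ∂_r Φ = D V` at `r = 0`
  have hsymm : ∀ v, D₂ (1, 0) (0, v) = fderiv ℝ V y v := fun v => by
    rw [hVd.fderiv]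
    exact (hΦ.isSymmSndFDerivAt (by simp)) (1, 0) (0, v)
  -- the pull-back of `X` along the flow and its derivative
  have hΦy : Φ (0, y) = y := hΦ0.self_of_nhds
  have hXd : HasDerivAt (fun r => X (Φ (r, y))) (fderiv ℝ X y (V y)) 0 := by
    have hX' : HasFDerivAt X (fderiv ℝ X y) (Φ (0, y)) := by rw [hΦy]; exact hX.hasFDerivAt
    exact hX'.comp_hasDerivAt (0 : ℝ) hV.self_of_nhds
  have hinv : HasDerivAt (fun r => Ring.inverse (A r))
      (-(D₂ (1, 0)).comp (ContinuousLinearMap.inr ℝ ℝ E)) 0 := by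
    have h1 := hasFDerivAt_ringInverse (𝕜 := ℝ) (1 : (E →L[ℝ] E)ˣ)
    have h2 : HasFDerivAt Ring.inverse
      (-(ContinuousLinearMap.mulLeftRight ℝ (E →L[ℝ] E)) 1 1) (A 0) := by
      rw [hA0]; simpa using! h1
    simpa using! h2.comp_hasDerivAt (0 : ℝ) hAd
  set e : ℝ → E := fun r => Ring.inverse (A r) (X (Φ (r, y)))
  have he : HasDerivAt e (VectorField.lieBracket ℝ V X y) 0 := by
    refine (hinv.clm_apply hXd).congr_deriv ?_
    simp [VectorField.lieBracket, hA0, hΦy, hsymm]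
    abel
  have he0 : e 0 = X y := by simp [e, hA0, hΦy]
  have hunit : ∀ᶠ r in 𝓝 (0 : ℝ), IsUnit (A r) :=
    hAd.continuousAt.eventually (hA0 ▸ Units.nhds (1 : (E →L[ℝ] E)ˣ))
  have heF : ∀ᶠ r in 𝓝[<] (0 : ℝ), e r ∈ F := by
    filter_upwards [hF, nhdsWithin_le_nhds hA, nhdsWithin_le_nhds hunit] with r hr h1 h2
    rw [h1] at hr
    obtain ⟨f, hf, hfr⟩ := hr
    have : e r = f := by
      simp only [e, ← hfr]
      exact DFunLike.congr_fun (Ring.inverse_mul_cancel _ h2) f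
    rwa [this]
  have hFc : IsClosed (F : Set E) := F.closed_of_finiteDimensional
  have hmem : X y ∈ F := by
    rw [← he0]
    exact hFc.mem_of_tendsto (he.continuousAt.tendsto.mono_left nhdsWithin_le_nhds) heF
  refine ⟨hmem, hFc.mem_of_tendsto
    ((hasDerivAt_iff_tendsto_slope.1 he).mono_left
      (nhdsWithin_mono _ fun r (hr : r ∈ Iio 0) => ne_of_lt hr)) ?_⟩
  filter_upwards [heF] with r hr
  rw [slope_def_module, he0]
  exact F.smul_mem _ (F.sub_mem hr hmem)

namespace ControlSystem

variable {U : Type*} {n : ℕ} {M : Type*} [TopologicalSpace M]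
  [ChartedSpace (EuclideanSpace ℝ (Fin n)) M] [IsManifold (𝓡 n) ∞ M]
  {S : ControlSystem U n M} {d : ℕ} {g : Fin d → U}

/-! ### Chronological products -/

theorem chron_cons (i : Fin d) (w : List (Fin d)) (t : Fin (i :: w).length → ℝ) (x : M) :
    S.chron g (i :: w) t x = S.flow (g i) (t 0) (S.chron g w (Fin.tail t) x) := by
  simp only [chron]
  rw [List.ofFn_succ]
  rfl

theorem flow_neg_flow (u : U) (r : ℝ) (x : M) : S.flow u (-r) (S.flow u r x) = x := by
  rw [← S.flow_add, neg_add_cancel, S.flow_zero]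

theorem contMDiff_flow_right (u : U) (r : ℝ) : ContMDiff (𝓡 n) (𝓡 n) ∞ (S.flow u r) :=
  (S.smooth_flow u).comp (contMDiff_const.prodMk contMDiff_id)

theorem contMDiff_chron (w : List (Fin d)) (x : M) :
    ContMDiff 𝓘(ℝ, Fin w.length → ℝ) (𝓡 n) ∞ (fun t => S.chron g w t x) := by
  induction w with
  | nil => exact contMDiff_const
  | cons i w ih =>
    simp only [chron_cons]
    refine (S.smooth_flow (g i)).comp (ContMDiff.prodMk ?_ (ih.comp ?_))
    · exact (contDiff_apply ℝ ℝ (0 : Fin (w.length + 1))).contMDiff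
    · refine ContDiff.contMDiff (contDiff_pi.2 fun j => ?_)
      exact contDiff_apply ℝ ℝ (j.succ : Fin (w.length + 1))

theorem chron_cons_cons (i : Fin d) (w : List (Fin d)) (r : ℝ) (t : Fin w.length → ℝ) (x : M) :
    S.chron g (i :: w) (Fin.cons r t : Fin (w.length + 1) → ℝ) x =
      S.flow (g i) r (S.chron g w t x) := by
  rw [chron_cons]
  rfl

theorem surjective_mfderiv_flow (u : U) (r : ℝ) (x : M) :
    Function.Surjective (mfderiv (𝓡 n) (𝓡 n) (S.flow u r) x) := by
  have key : ∀ y, Function.Surjective (mfderiv (𝓡 n) (𝓡 n) (S.flow u r) (S.flow u (-r) y)) := by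
    intro y
    have h1 := mfderiv_comp y ((contMDiff_flow_right (S := S) u r).mdifferentiableAt (by simp))
      ((contMDiff_flow_right (S := S) u (-r)).mdifferentiableAt (x := y) (by simp))
    have h2 : S.flow u r ∘ S.flow u (-r) = id := by
      ext y
      simp [← S.flow_add, S.flow_zero]
    rw [h2, mfderiv_id] at h1
    exact fun v => ⟨mfderiv (𝓡 n) (𝓡 n) (S.flow u (-r)) y v, (DFunLike.congr_fun h1 v).symm⟩
  have := key (S.flow u r x)
  rwa [flow_neg_flow] at this

theorem notMem_exceptionalSet {w : List (Fin d)} {x : M} {t : Fin w.length → ℝ} :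
    t ∉ S.exceptionalSet g w x ↔ Function.Surjective
      (mfderiv 𝓘(ℝ, Fin w.length → ℝ) (𝓡 n) (fun s => S.chron g w s x) t) := not_not

/-- A chronological product with a regular time remains regular when one more flow is applied. -/
theorem cons_notMem_exceptionalSet {w : List (Fin d)} {x : M} {t : Fin w.length → ℝ}
    (h : t ∉ S.exceptionalSet g w x) (i : Fin d) (r : ℝ) :
    (Fin.cons r t : Fin (w.length + 1) → ℝ) ∉ S.exceptionalSet g (i :: w) x := by
  rw [notMem_exceptionalSet] at h ⊢
  have hcons : MDifferentiableAt 𝓘(ℝ, Fin w.length → ℝ) 𝓘(ℝ, Fin (w.length + 1) → ℝ)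
      (fun s : Fin w.length → ℝ => (Fin.cons r s : Fin (w.length + 1) → ℝ)) t := by
    refine DifferentiableAt.mdifferentiableAt (differentiableAt_pi.2 fun j => ?_)
    refine Fin.cases ?_ (fun j => ?_) j
    · simp
    · simpa using! differentiableAt_apply j t
  let D : (Fin w.length → ℝ) →L[ℝ] EuclideanSpace ℝ (Fin n) :=
    (mfderiv 𝓘(ℝ, Fin (w.length + 1) → ℝ) (𝓡 n) (fun s => S.chron g (i :: w) s x)
      (Fin.cons r t : Fin (w.length + 1) → ℝ)).comp (mfderiv 𝓘(ℝ, Fin w.length → ℝ)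
      𝓘(ℝ, Fin (w.length + 1) → ℝ)
      (fun s : Fin w.length → ℝ => (Fin.cons r s : Fin (w.length + 1) → ℝ)) t)
  have h1 : HasMFDerivAt 𝓘(ℝ, Fin w.length → ℝ) (𝓡 n)
      ((fun s => S.chron g (i :: w) s x) ∘
        (fun s : Fin w.length → ℝ => (Fin.cons r s : Fin (w.length + 1) → ℝ))) t D :=
    HasMFDerivAt.comp t (((contMDiff_chron (S := S) (g := g) (i :: w) x).mdifferentiableAt
      (by simp)).hasMFDerivAt) hcons.hasMFDerivAt
  have h0 : ((fun s => S.chron g (i :: w) s x) ∘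
      (fun s : Fin w.length → ℝ => (Fin.cons r s : Fin (w.length + 1) → ℝ))) =
      S.flow (g i) r ∘ fun s => S.chron g w s x := funext fun s => chron_cons_cons i w r s x
  rw [h0] at h1
  have h2 := mfderiv_comp t ((contMDiff_flow_right (S := S) (g i) r).mdifferentiableAt (by simp))
    ((contMDiff_chron (S := S) (g := g) w x).mdifferentiableAt (x := t) (by simp))
  intro v
  obtain ⟨v', hv'⟩ := surjective_mfderiv_flow (S := S) (g i) r (S.chron g w t x) v
  obtain ⟨v'', rfl⟩ := h v'
  exact ⟨_, (DFunLike.congr_fun (h1.mfderiv.symm.trans h2) v'').trans hv'⟩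

/-- Regular times are the times at which the differential, written in a chart, is onto. -/
theorem notMem_exceptionalSet_iff {w : List (Fin d)} {x c : M} {t : Fin w.length → ℝ}
    (hc : S.chron g w t x ∈ (chartAt (EuclideanSpace ℝ (Fin n)) c).source) :
    t ∉ S.exceptionalSet g w x ↔ Function.Surjective (fderiv ℝ
      (fun s => chartAt (EuclideanSpace ℝ (Fin n)) c (S.chron g w s x)) t) := by
  rw [notMem_exceptionalSet]
  have h1 : MDifferentiableAt 𝓘(ℝ, Fin w.length → ℝ) (𝓡 n) (fun s => S.chron g w s x) t :=
    (contMDiff_chron w x).contMDiffAt.mdifferentiableAt (by simp)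
  obtain ⟨e, he⟩ := isInvertible_mfderiv_extChartAt (I := 𝓡 n) (x := c) (y := S.chron g w t x)
    (by simpa using hc)
  let D : EuclideanSpace ℝ (Fin n) →L[ℝ] EuclideanSpace ℝ (Fin n) :=
    mfderiv (𝓡 n) 𝓘(ℝ, EuclideanSpace ℝ (Fin n)) (extChartAt (𝓡 n) c) (S.chron g w t x)
  have hD : Function.Bijective D := by
    have : Function.Bijective e := e.bijective
    have h : (e : _ → _) = D := congrArg DFunLike.coe he
    exact h ▸ this
  let L : (Fin w.length → ℝ) →L[ℝ] EuclideanSpace ℝ (Fin n) :=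
    mfderiv 𝓘(ℝ, Fin w.length → ℝ) (𝓡 n) (fun s => S.chron g w s x) t
  have h4 : HasFDerivAt (fun s => chartAt (EuclideanSpace ℝ (Fin n)) c (S.chron g w s x))
      (D.comp L) t := hasMFDerivAt_iff_hasFDerivAt.1
    ((mdifferentiableAt_extChartAt (I := 𝓡 n) hc).hasMFDerivAt.comp t h1.hasMFDerivAt)
  rw [h4.fderiv, ContinuousLinearMap.coe_comp, Function.Surjective.of_comp_iff' hD]
  exact Iff.rfl

/-! ### Commutators in coordinates -/

theorem isManifold_minSmoothness_three :
    IsManifold (𝓡 n) (minSmoothness ℝ 3) M :=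
  IsManifold.of_le (n := ∞) (by
    rw [minSmoothness_of_isRCLikeNormedField]
    exact WithTop.coe_le_coe.2 (le_top : (3 : ℕ∞) ≤ ⊤))

theorem contMDiff_commutator (w : List (Fin d)) :
    ContMDiff (𝓡 n) (𝓡 n).tangent ∞
      (fun x => (⟨x, S.commutator g w x⟩ : TangentBundle (𝓡 n) M)) := by
  have : IsManifold (𝓡 n) (∞ + 1) M := ‹IsManifold (𝓡 n) ∞ M›
  have := isManifold_minSmoothness_three (n := n) (M := M)
  induction w with
  | nil =>
    exact Bundle.contMDiff_zeroSection ℝ (TangentSpace (𝓡 n) (M := M)) (IB := 𝓡 n)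
  | cons i w ih =>
    cases w with
    | nil => exact S.smooth_V (g i)
    | cons j w =>
      exact ContDiff.mlieBracket_vectorField (m := ⊤) (n := ⊤) (S.smooth_V (g i)) ih (by simp)

theorem contDiffOn_fieldCoord_symm {X : (x : M) → TangentSpace (𝓡 n) x}
    (hX : ContMDiff (𝓡 n) (𝓡 n).tangent ∞ (fun x => (⟨x, X x⟩ : TangentBundle (𝓡 n) M))) (c : M) :
    ContDiffOn ℝ ∞ (fun y => fieldCoord c X ((chartAt (EuclideanSpace ℝ (Fin n)) c).symm y))
      (chartAt (EuclideanSpace ℝ (Fin n)) c).target :=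
  contMDiffOn_iff_contDiffOn.1 ((contMDiffOn_fieldCoord hX c).comp contMDiffOn_chart_symm
    (fun _ hy => (chartAt (EuclideanSpace ℝ (Fin n)) c).map_target hy))

/-- The coordinates of a field in a chart are its pull-back by the inverse of the chart. -/
theorem mpullback_chart_symm (X : (x : M) → TangentSpace (𝓡 n) x) (c : M)
    {y : EuclideanSpace ℝ (Fin n)} (hy : y ∈ (chartAt (EuclideanSpace ℝ (Fin n)) c).target) :
    VectorField.mpullback 𝓘(ℝ, EuclideanSpace ℝ (Fin n)) (𝓡 n) (extChartAt (𝓡 n) c).symm X y =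
      fieldCoord c X ((chartAt (EuclideanSpace ℝ (Fin n)) c).symm y) := by
  have : IsManifold (𝓡 n) 1 M := IsManifold.of_le (n := ∞) (by simp)
  have hy' : y ∈ (extChartAt (𝓡 n) c).target := by simpa using hy
  have h1 := mfderiv_extChartAt_comp_mfderivWithin_extChartAt_symm hy'
  have h2 := mfderivWithin_extChartAt_symm_comp_mfderiv_extChartAt hy'
  rw [modelWithCornersSelf_coe, range_id, mfderivWithin_univ] at h1 h2
  rw [VectorField.mpullback_apply, ContinuousLinearMap.inverse_eq h2 h1]
  have h3 := mfderiv_chartAt_eq_tangentCoordChange (I := 𝓡 n)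
    ((chartAt (EuclideanSpace ℝ (Fin n)) c).map_target hy)
  exact DFunLike.congr_fun h3 (X ((chartAt (EuclideanSpace ℝ (Fin n)) c).symm y))

/-- Lie brackets may be computed in the coordinates of a chart. -/
theorem fieldCoord_mlieBracket {X Y : (x : M) → TangentSpace (𝓡 n) x}
    (hX : ContMDiff (𝓡 n) (𝓡 n).tangent ∞ (fun x => (⟨x, X x⟩ : TangentBundle (𝓡 n) M)))
    (hY : ContMDiff (𝓡 n) (𝓡 n).tangent ∞ (fun x => (⟨x, Y x⟩ : TangentBundle (𝓡 n) M))) (c : M)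
    {y : EuclideanSpace ℝ (Fin n)} (hy : y ∈ (chartAt (EuclideanSpace ℝ (Fin n)) c).target) :
    fieldCoord c (VectorField.mlieBracket (𝓡 n) X Y)
        ((chartAt (EuclideanSpace ℝ (Fin n)) c).symm y) =
      VectorField.lieBracket ℝ
        (fun z => fieldCoord c X ((chartAt (EuclideanSpace ℝ (Fin n)) c).symm z))
        (fun z => fieldCoord c Y ((chartAt (EuclideanSpace ℝ (Fin n)) c).symm z)) y := by
  have := isManifold_minSmoothness_three (n := n) (M := M)
  let P : ((x : M) → TangentSpace (𝓡 n) x) → EuclideanSpace ℝ (Fin n) → EuclideanSpace ℝ (Fin n) :=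
    fun Z z => VectorField.mpullback 𝓘(ℝ, EuclideanSpace ℝ (Fin n)) (𝓡 n)
      (extChartAt (𝓡 n) c).symm Z z
  have hev : ∀ Z, P Z =ᶠ[𝓝 y]
      fun z => fieldCoord c Z ((chartAt (EuclideanSpace ℝ (Fin n)) c).symm z) := fun Z => by
    filter_upwards [(chartAt (EuclideanSpace ℝ (Fin n)) c).open_target.mem_nhds hy] with z hz
    exact mpullback_chart_symm Z c hz
  have h1 := VectorField.mpullback_mlieBracket (I := 𝓘(ℝ, EuclideanSpace ℝ (Fin n))) (I' := 𝓡 n)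
    (f := (extChartAt (𝓡 n) c).symm) (x₀ := y) (n := ∞)
    ((hX _).mdifferentiableAt (by simp)) ((hY _).mdifferentiableAt (by simp))
    (((contMDiffOn_extChartAt_symm c).contMDiffAt
      ((isOpen_extChartAt_target c).mem_nhds (by simpa using hy)))) (by
        rw [minSmoothness_of_isRCLikeNormedField]
        exact WithTop.coe_le_coe.2 (le_top : (2 : ℕ∞) ≤ ⊤))
  have h2 : ∀ A B : EuclideanSpace ℝ (Fin n) → EuclideanSpace ℝ (Fin n),
      VectorField.mlieBracket 𝓘(ℝ, EuclideanSpace ℝ (Fin n)) A B y =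
        VectorField.lieBracket ℝ A B y := fun A B =>
    (congrFun (VectorField.mlieBracketWithin_eq_lieBracketWithin (V := A) (W := B) (s := univ))
      y).trans (congrFun VectorField.lieBracketWithin_univ y)
  have h3 : VectorField.lieBracket ℝ (P X) (P Y) y = _ :=
    Filter.EventuallyEq.lieBracket_vectorField_eq (hev X) (hev Y)
  rw [mpullback_chart_symm _ c hy] at h1
  exact h1.trans ((h2 (P X) (P Y)).trans h3)

/-! ### The rank condition near `q` -/

theorem finite_systemWords (C : Finset (List (Fin d))) : (systemWords C).Finite := by
  have : systemWords C = range (fun i : Fin d => [i]) ∪ C := by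
    ext w; simp [systemWords, eq_comm]
  rw [this]
  exact (finite_range _).union C.finite_toSet

/-- The Lie algebra rank condition is open: it persists near `q`. -/
theorem SatisfiesLARC.eventually {C : Finset (List (Fin d))} {q : M}
    (h : S.SatisfiesLARC g C q) : ∀ᶠ x in 𝓝 q, Submodule.span ℝ
      {v | ∃ w ∈ systemWords C, v = fieldCoord q (S.commutator g w) x} = ⊤ := by
  have : Fintype (systemWords C) := (finite_systemWords C).fintype
  let L : M → (systemWords C → ℝ) →L[ℝ] EuclideanSpace ℝ (Fin n) := fun x =>
    ∑ w, (ContinuousLinearMap.proj w : (systemWords C → ℝ) →L[ℝ] ℝ).smulRight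
      (fieldCoord q (S.commutator g w) x)
  have hL : ∀ x, (L x : (systemWords C → ℝ) →ₗ[ℝ] EuclideanSpace ℝ (Fin n)) =
      Fintype.linearCombination ℝ (fun w : systemWords C => fieldCoord q (S.commutator g w) x) := by
    intro x
    ext1 w
    ext
    simp [L, Fintype.linearCombination_apply]
  have hrange : ∀ x, LinearMap.range (L x : (systemWords C → ℝ) →ₗ[ℝ] EuclideanSpace ℝ (Fin n)) =
      Submodule.span ℝ {v | ∃ w ∈ systemWords C, v = fieldCoord q (S.commutator g w) x} := by
    intro x
    rw [hL, Fintype.range_linearCombination]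
    congr 1
    ext v
    simp [eq_comm]
  have hcont : ContinuousAt L q := by
    refine tendsto_finsetSum _ fun w _ => ?_
    have h1 : ContinuousAt (fieldCoord q (S.commutator g w)) q :=
      (contMDiffOn_fieldCoord (contMDiff_commutator _) q).continuousOn.continuousAt
        ((chartAt (EuclideanSpace ℝ (Fin n)) q).open_source.mem_nhds (mem_chart_source _ _))
    exact ((ContinuousLinearMap.smulRightL ℝ (systemWords C → ℝ) (EuclideanSpace ℝ (Fin n))
      (ContinuousLinearMap.proj w)).continuous.continuousAt.comp h1)
  -- the chart at `q` is the one in which tangent vectors at `q` are represented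
  have hq : Function.Surjective (L q) := by
    refine LinearMap.range_eq_top.1 ((hrange q).trans ?_)
    have h1 : ∀ w, fieldCoord q (S.commutator g w) q = S.commutator g w q := fun w =>
      tangentCoordChange_self (mem_extChartAt_source q)
    simp only [h1]
    exact h
  filter_upwards [hcont.eventually (ContinuousLinearMap.eventually_surjective hq)] with x hx
  rw [← hrange]
  exact LinearMap.range_eq_top.2 hx

/-! ### The differential of a chronological product -/

theorem contDiffAt_chart_flow (u : U) {c : M} {r : ℝ} {y : EuclideanSpace ℝ (Fin n)}
    (hy : y ∈ (chartAt (EuclideanSpace ℝ (Fin n)) c).target)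
    (hr : S.flow u r ((chartAt (EuclideanSpace ℝ (Fin n)) c).symm y) ∈
      (chartAt (EuclideanSpace ℝ (Fin n)) c).source) :
    ContDiffAt ℝ ∞ (fun p : ℝ × EuclideanSpace ℝ (Fin n) =>
      chartAt (EuclideanSpace ℝ (Fin n)) c
        (S.flow u p.1 ((chartAt (EuclideanSpace ℝ (Fin n)) c).symm p.2))) (r, y) := by
  set φ := chartAt (EuclideanSpace ℝ (Fin n)) c
  have h1 : ContMDiffAt 𝓘(ℝ, ℝ × EuclideanSpace ℝ (Fin n)) (𝓡 n) ∞
      (fun p : ℝ × EuclideanSpace ℝ (Fin n) => φ.symm p.2) (r, y) :=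
    ContMDiffAt.comp (I' := 𝓡 n) (r, y)
      ((contMDiffOn_chart_symm (I := 𝓡 n) (n := ∞)).contMDiffAt (φ.open_target.mem_nhds hy))
      contDiff_snd.contMDiff.contMDiffAt
  have h2 : ContMDiffAt 𝓘(ℝ, ℝ × EuclideanSpace ℝ (Fin n)) (𝓡 n) ∞
      (fun p : ℝ × EuclideanSpace ℝ (Fin n) => S.flow u p.1 (φ.symm p.2)) (r, y) :=
    (S.smooth_flow u).contMDiffAt.comp (r, y) (contDiff_fst.contMDiff.contMDiffAt.prodMk h1)
  exact contMDiffAt_iff_contDiffAt.1 (ContMDiffAt.comp (I' := 𝓡 n) (r, y)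
    ((contMDiffOn_chart (I := 𝓡 n) (n := ∞)).contMDiffAt (φ.open_source.mem_nhds hr)) h2)

theorem contDiffAt_chart_chron (w : List (Fin d)) (x : M) {c : M} {t : Fin w.length → ℝ}
    (hc : S.chron g w t x ∈ (chartAt (EuclideanSpace ℝ (Fin n)) c).source) :
    ContDiffAt ℝ ∞ (fun s => chartAt (EuclideanSpace ℝ (Fin n)) c (S.chron g w s x)) t := by
  have h1 := (contMDiffOn_chart (I := 𝓡 n) (n := ∞) (x := c) (M := M)).contMDiffAt
    ((chartAt (EuclideanSpace ℝ (Fin n)) c).open_source.mem_nhds hc)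
  exact contMDiffAt_iff_contDiffAt.1 (h1.comp t (contMDiff_chron (S := S) (g := g) w x t))

/-- The differential at `y` of the flow `P_u^r`, both written in the chart at `c`. -/
noncomputable def flowDeriv (S : ControlSystem U n M) (u : U) (c : M) (r : ℝ)
    (y : EuclideanSpace ℝ (Fin n)) : EuclideanSpace ℝ (Fin n) →L[ℝ] EuclideanSpace ℝ (Fin n) :=
  fderiv ℝ (fun z => chartAt (EuclideanSpace ℝ (Fin n)) c
    (S.flow u r ((chartAt (EuclideanSpace ℝ (Fin n)) c).symm z))) y

/-- The range, in the chart at `c`, of the differential at `t` of the chronological product of `w`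
applied to `x`. -/
noncomputable def chronRange (S : ControlSystem U n M) (g : Fin d → U) (c x : M)
    (w : List (Fin d)) (t : Fin w.length → ℝ) : Submodule ℝ (EuclideanSpace ℝ (Fin n)) :=
  LinearMap.range (fderiv ℝ
    (fun s => chartAt (EuclideanSpace ℝ (Fin n)) c (S.chron g w s x)) t).toLinearMap

theorem hasFDerivAt_chart_flow (u : U) {c x : M} {r : ℝ}
    (hx : x ∈ (chartAt (EuclideanSpace ℝ (Fin n)) c).source)
    (hr : S.flow u r x ∈ (chartAt (EuclideanSpace ℝ (Fin n)) c).source) :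
    HasFDerivAt (fun z => chartAt (EuclideanSpace ℝ (Fin n)) c
      (S.flow u r ((chartAt (EuclideanSpace ℝ (Fin n)) c).symm z)))
      (flowDeriv S u c r (chartAt (EuclideanSpace ℝ (Fin n)) c x))
      (chartAt (EuclideanSpace ℝ (Fin n)) c x) := by
  set φ := chartAt (EuclideanSpace ℝ (Fin n)) c
  have h := (contDiffAt_chart_flow (S := S) u (c := c) (r := r) (φ.map_source hx)
    (by rwa [φ.left_inv hx])).differentiableAt (by simp)
  have h2 : DifferentiableAt ℝ (fun z : EuclideanSpace ℝ (Fin n) => φ (S.flow u r (φ.symm z)))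
      (φ x) :=
    h.comp (φ x) (f := fun z : EuclideanSpace ℝ (Fin n) => (r, z)) (by fun_prop)
  exact h2.hasFDerivAt

/-- The flow at time `-r` provides a left inverse. -/
theorem injective_flowDeriv (u : U) {c x : M} {r : ℝ}
    (hx : x ∈ (chartAt (EuclideanSpace ℝ (Fin n)) c).source)
    (hr : S.flow u r x ∈ (chartAt (EuclideanSpace ℝ (Fin n)) c).source) :
    Function.Injective (flowDeriv S u c r (chartAt (EuclideanSpace ℝ (Fin n)) c x)) := by
  set φ := chartAt (EuclideanSpace ℝ (Fin n)) c
  have h1 := hasFDerivAt_chart_flow (S := S) u hx hr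
  have hb : S.flow u (-r) (S.flow u r x) ∈ φ.source := by rwa [flow_neg_flow]
  have h2 := hasFDerivAt_chart_flow (S := S) u hr hb
  have h2' : HasFDerivAt (fun z => φ (S.flow u (-r) (φ.symm z)))
      (flowDeriv S u c (-r) (φ (S.flow u r x))) (φ (S.flow u r (φ.symm (φ x)))) := by
    rw [φ.left_inv hx]; exact h2
  have h3 := h2'.comp (φ x) h1
  have h4 : (fun z => φ (S.flow u (-r) (φ.symm z))) ∘ (fun z => φ (S.flow u r (φ.symm z)))
      =ᶠ[𝓝 (φ x)] id := by
    have e1 : ∀ᶠ z in 𝓝 (φ x), z ∈ φ.target := φ.open_target.mem_nhds (φ.map_source hx)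
    have e2 : ContinuousAt (fun z => S.flow u r (φ.symm z)) (φ x) :=
      (contMDiff_flow_right u r).continuous.continuousAt.comp
        (φ.symm.continuousAt (φ.map_source hx))
    have e3 : ∀ᶠ z in 𝓝 (φ x), S.flow u r (φ.symm z) ∈ φ.source :=
      e2.eventually_mem (φ.open_source.mem_nhds (by rwa [φ.left_inv hx]))
    filter_upwards [e1, e3] with z hz1 hz3
    simp only [Function.comp_apply, id]
    rw [φ.left_inv hz3, flow_neg_flow, φ.right_inv hz1]
  have h5 := (h3.congr_of_eventuallyEq h4.symm).unique (hasFDerivAt_id _)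
  exact Function.LeftInverse.injective (fun v => DFunLike.congr_fun h5 v)

/-- Variations of the old times, transported by the new flow. -/
theorem map_flowDeriv_chronRange_le (i : Fin d) {c x : M} {w : List (Fin d)} {r : ℝ}
    {t : Fin w.length → ℝ}
    (hx : S.chron g w t x ∈ (chartAt (EuclideanSpace ℝ (Fin n)) c).source)
    (hr : S.flow (g i) r (S.chron g w t x) ∈ (chartAt (EuclideanSpace ℝ (Fin n)) c).source) :
    (chronRange S g c x w t).map (flowDeriv S (g i) c r
        (chartAt (EuclideanSpace ℝ (Fin n)) c (S.chron g w t x))).toLinearMap ≤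
      chronRange S g c x (i :: w) (Fin.cons r t : Fin (w.length + 1) → ℝ) := by
  set φ := chartAt (EuclideanSpace ℝ (Fin n)) c
  have h1 := ((contDiffAt_chart_chron (S := S) (g := g) w x hx).differentiableAt
    (by simp)).hasFDerivAt
  have h2 := (hasFDerivAt_chart_flow (S := S) (g i) hx hr).comp t h1
  have h3 := ((contDiffAt_chart_chron (S := S) (g := g) (i :: w) x (c := c)
    (t := (Fin.cons r t : Fin (w.length + 1) → ℝ))
    (by rwa [chron_cons_cons])).differentiableAt (by simp)).hasFDerivAt
  have hcons : DifferentiableAt ℝ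
      (fun s : Fin w.length → ℝ => (Fin.cons r s : Fin (w.length + 1) → ℝ)) t := by
    refine differentiableAt_pi.2 fun j => Fin.cases ?_ (fun j => ?_) j
    · simp
    · simpa using! differentiableAt_apply j t
  have h4 := h3.comp t hcons.hasFDerivAt
  have hsrc : ∀ᶠ s in 𝓝 t, S.chron g w s x ∈ φ.source :=
    (contMDiff_chron w x).continuous.continuousAt.eventually_mem (φ.open_source.mem_nhds hx)
  have h5 := h4.congr_of_eventuallyEq (f₁ := (fun z => φ (S.flow (g i) r (φ.symm z))) ∘
      fun s => φ (S.chron g w s x)) (by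
    filter_upwards [hsrc] with s hs
    simp only [Function.comp_apply]
    rw [φ.left_inv hs, chron_cons_cons])
  have h6 := h2.unique h5
  rintro _ ⟨_, ⟨v, rfl⟩, rfl⟩
  exact ⟨_, (DFunLike.congr_fun h6 v).symm⟩

/-- Variation of the time of the outermost flow. -/
theorem coordV_mem_chronRange (i : Fin d) {c x : M} {w : List (Fin d)} {r : ℝ}
    {t : Fin w.length → ℝ}
    (hr : S.flow (g i) r (S.chron g w t x) ∈ (chartAt (EuclideanSpace ℝ (Fin n)) c).source) :
    S.coordV c (g i) (S.flow (g i) r (S.chron g w t x)) ∈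
      chronRange S g c x (i :: w) (Fin.cons r t : Fin (w.length + 1) → ℝ) := by
  have h1 := hasDerivAt_chart_flow (S := S) (g i) c _ hr
  have h3 := ((contDiffAt_chart_chron (S := S) (g := g) (i :: w) x (c := c)
    (t := (Fin.cons r t : Fin (w.length + 1) → ℝ))
    (by rwa [chron_cons_cons])).differentiableAt (by simp)).hasFDerivAt
  have hcons : DifferentiableAt ℝ (fun h : ℝ => (Fin.cons h t : Fin (w.length + 1) → ℝ)) r := by
    refine differentiableAt_pi.2 fun j => Fin.cases ?_ (fun j => ?_) j
    · simp
    · simp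
  have h4 := h3.comp_hasDerivAt r hcons.hasDerivAt
  have h5 : HasDerivAt (fun h => chartAt (EuclideanSpace ℝ (Fin n)) c
      (S.flow (g i) h (S.chron g w t x))) _ r :=
    h4.congr_of_eventuallyEq (.of_forall fun h => by
      simp only [Function.comp_apply]; rw [chron_cons_cons])
  exact ⟨_, (h1.unique h5).symm⟩

/-! ### Regular times -/

/-- If, along the flow of `V_u` backwards from `x`, a vector field stays in the subspaces
transported from `F` by the flow, then `F` contains it and its bracket with `V_u` at `x`. -/
theorem fieldCoord_mem_of_flow {X : (x : M) → TangentSpace (𝓡 n) x}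
    (hX : ContMDiff (𝓡 n) (𝓡 n).tangent ∞ (fun x => (⟨x, X x⟩ : TangentBundle (𝓡 n) M)))
    (u : U) {c x : M} (hx : x ∈ (chartAt (EuclideanSpace ℝ (Fin n)) c).source)
    (F : Submodule ℝ (EuclideanSpace ℝ (Fin n)))
    (hF : ∀ᶠ r in 𝓝[<] (0 : ℝ), fieldCoord c X (S.flow u r x) ∈
      F.map (flowDeriv S u c r (chartAt (EuclideanSpace ℝ (Fin n)) c x)).toLinearMap) :
    fieldCoord c X x ∈ F ∧ fieldCoord c (VectorField.mlieBracket (𝓡 n) (S.V u) X) x ∈ F := by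
  set φ := chartAt (EuclideanSpace ℝ (Fin n)) c with hφ
  have hy : φ x ∈ φ.target := φ.map_source hx
  have h0 : S.flow u 0 (φ.symm (φ x)) ∈ φ.source := by rwa [S.flow_zero, φ.left_inv hx]
  have hsrc : ∀ᶠ r in 𝓝 (0 : ℝ), S.flow u r x ∈ φ.source :=
    (continuous_flow_curve u x).continuousAt.eventually_mem
      (φ.open_source.mem_nhds (by rwa [S.flow_zero]))
  have htgt : ∀ᶠ z in 𝓝 (φ x), z ∈ φ.target := φ.open_target.mem_nhds hy
  have key := mem_and_lieBracket_mem_of_flow (y := φ x)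
    (Φ := fun p : ℝ × EuclideanSpace ℝ (Fin n) => φ (S.flow u p.1 (φ.symm p.2)))
    (V := fun z => fieldCoord c (S.V u) (φ.symm z)) (X := fun z => fieldCoord c X (φ.symm z)) F
    ((contDiffAt_chart_flow u hy h0).of_le (WithTop.coe_le_coe.2 (le_top : (2 : ℕ∞) ≤ ⊤)))
    (by
      filter_upwards [htgt] with z hz
      simp only [S.flow_zero]
      exact φ.right_inv hz)
    (by
      filter_upwards [htgt] with z hz
      have h := hasDerivAt_chart_flow (S := S) u c (φ.symm z) (t := 0)
        (by rw [S.flow_zero]; exact φ.map_target hz)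
      rwa [S.flow_zero] at h)
    (((contDiffOn_fieldCoord_symm hX c).contDiffAt (φ.open_target.mem_nhds hy)).differentiableAt
      (by simp))
    (by
      filter_upwards [hF, nhdsWithin_le_nhds hsrc] with r hr hr'
      simp only [φ.left_inv hx, φ.left_inv hr']
      exact hr)
  rw [← fieldCoord_mlieBracket (S.smooth_V u) hX c hy] at key
  simpa only [← hφ, φ.left_inv hx] using key

/-- Under the Lie algebra rank condition some chronological product has regular negative times.
Among the products with negative times that end near `q`, take one whose differential has the
largest rank. Its range then contains all generators and, with each field, the brackets with the
generators, because applying one more flow cannot increase the rank. Hence it is the whole tangent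
space. -/
theorem exists_notMem_exceptionalSet {C : Finset (List (Fin d))} {q : M}
    (h : S.SatisfiesLARC g C q) :
    ∃ (w : List (Fin d)) (t : Fin w.length → ℝ), (∀ i, t i < 0) ∧ t ∉ S.exceptionalSet g w q := by
  set φ := chartAt (EuclideanSpace ℝ (Fin n)) q
  obtain ⟨W, hW, hWo, hqW⟩ := eventually_nhds_iff.1
    (h.eventually.and (φ.open_source.mem_nhds (mem_chart_source _ q)))
  have hWs : ∀ x ∈ W, x ∈ φ.source := fun x hx => (hW x hx).2
  let ranks : Set ℕ := {k | ∃ (w : List (Fin d)) (t : Fin w.length → ℝ), (∀ i, t i < 0) ∧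
    S.chron g w t q ∈ W ∧ Module.finrank ℝ (chronRange S g q q w t) = k}
  have hne : ranks.Nonempty := ⟨_, [], fun i => i.elim0, fun i => i.elim0, hqW, rfl⟩
  have hbdd : BddAbove ranks := ⟨n, by
    rintro _ ⟨w, t, -, -, rfl⟩
    simpa using Submodule.finrank_le (chronRange S g q q w t)⟩
  set k := sSup ranks
  have hk : k ∈ ranks := Nat.sSup_mem hne hbdd
  let Good : (w : List (Fin d)) → (Fin w.length → ℝ) → Prop := fun w t => (∀ i, t i < 0) ∧
    S.chron g w t q ∈ W ∧ Module.finrank ℝ (chronRange S g q q w t) = k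
  -- by maximality, one more flow merely transports the range
  have hstep : ∀ (w : List (Fin d)) (t : Fin w.length → ℝ) (i : Fin d), Good w t →
      ∀ᶠ r in 𝓝[<] (0 : ℝ), Good (i :: w) (Fin.cons r t : Fin (w.length + 1) → ℝ) ∧
        chronRange S g q q (i :: w) (Fin.cons r t : Fin (w.length + 1) → ℝ) =
          (chronRange S g q q w t).map
            (flowDeriv S (g i) q r (φ (S.chron g w t q))).toLinearMap := by
    intro w t i ⟨hneg, hmem, hrank⟩
    have hcont : ∀ᶠ r in 𝓝 (0 : ℝ), S.flow (g i) r (S.chron g w t q) ∈ W :=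
      (continuous_flow_curve (g i) _).continuousAt.eventually_mem
        (hWo.mem_nhds (by rwa [S.flow_zero]))
    filter_upwards [nhdsWithin_le_nhds hcont, self_mem_nhdsWithin] with r hrW (hr0 : r < 0)
    have hneg' : ∀ j, (Fin.cons r t : Fin (w.length + 1) → ℝ) j < 0 := fun j =>
      Fin.cases (by simpa using hr0) (fun j => by simpa using hneg j) j
    have hmem' : S.chron g (i :: w) (Fin.cons r t : Fin (w.length + 1) → ℝ) q ∈ W := by
      rwa [chron_cons_cons]
    have hle := map_flowDeriv_chronRange_le (S := S) (g := g) i (hWs _ hmem) (hWs _ hrW)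
    have hinj := injective_flowDeriv (S := S) (g i) (hWs _ hmem) (hWs _ hrW)
    have hfin := (Submodule.equivMapOfInjective
      (flowDeriv S (g i) q r (φ (S.chron g w t q))).toLinearMap hinj
      (chronRange S g q q w t)).finrank_eq.symm
    have hmax : Module.finrank ℝ
        (chronRange S g q q (i :: w) (Fin.cons r t : Fin (w.length + 1) → ℝ)) ≤ k :=
      le_csSup hbdd ⟨i :: w, _, hneg', hmem', rfl⟩
    have heq := Submodule.eq_of_le_of_finrank_le hle (by rw [hfin, hrank]; exact hmax)
    exact ⟨⟨hneg', hmem', by rw [← heq, hfin, hrank]⟩, heq.symm⟩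
  have hmain : ∀ (v w : List (Fin d)) (t : Fin w.length → ℝ), Good w t →
      fieldCoord q (S.commutator g v) (S.chron g w t q) ∈ chronRange S g q q w t := by
    intro v
    induction v with
    | nil =>
      intro w t _
      -- the empty word stands for the zero field
      have : fieldCoord q (S.commutator g []) (S.chron g w t q) = 0 := map_zero _
      rw [this]
      exact zero_mem _
    | cons i v ih =>
      intro w t hgood
      have hsrc := hWs _ hgood.2.1
      cases v with
      | nil =>
        refine (fieldCoord_mem_of_flow (S := S) (S.smooth_V (g i)) (g i) hsrc _ ?_).1
        filter_upwards [hstep w t i hgood] with r ⟨hr, heq⟩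
        rw [← heq]
        refine coordV_mem_chronRange i (hWs _ ?_)
        rw [← chron_cons_cons]
        exact hr.2.1
      | cons j v =>
        refine (fieldCoord_mem_of_flow (contMDiff_commutator (j :: v)) (g i) hsrc _ ?_).2
        filter_upwards [hstep w t i hgood] with r ⟨hr, heq⟩
        have := ih (i :: w) _ hr
        rwa [heq, chron_cons_cons] at this
  obtain ⟨w, t, hgood⟩ := hk
  refine ⟨w, t, hgood.1, (notMem_exceptionalSet_iff (hWs _ hgood.2.1)).2
    (LinearMap.range_eq_top.1 (top_le_iff.1 ?_))⟩
  rw [← (hW _ hgood.2.1).1, Submodule.span_le]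
  rintro _ ⟨v, -, rfl⟩
  exact hmain v w t hgood

/-! ### The set of general points -/

theorem finite_monomials (w : List (Fin d)) : (monomials w).Finite := by
  induction w with
  | nil => exact finite_empty
  | cons i w ih =>
    cases w with
    | nil => exact finite_singleton _
    | cons j w =>
      refine ((ih.image fun m => i :: m).union (ih.image fun m => m ++ [i])).subset ?_
      rintro m ⟨m', hm', rfl | rfl⟩
      · exact Or.inl ⟨m', hm', rfl⟩
      · exact Or.inr ⟨m', hm', rfl⟩

/-- Every word becomes general when a suitable word is put in front of it. -/
theorem exists_isGeneralWord_append (C : Finset (List (Fin d))) (w : List (Fin d)) :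
    ∃ w', IsGeneralWord C (w' ++ w) := by
  have hfin : {m | ∃ v ∈ systemWords C, m ∈ monomials v}.Finite := by
    refine ((finite_systemWords C).biUnion fun v _ => finite_monomials v).subset ?_
    rintro m ⟨v, hv, hm⟩
    exact mem_biUnion hv hm
  refine ⟨hfin.toFinset.toList.flatten, hfin.toFinset.toList ++ w.map fun i => [i], ?_, fun m => ?_⟩
  · rw [List.flatten_append]
    congr 1
    induction w with
    | nil => rfl
    | cons i w ih => rw [List.map_cons, List.flatten_cons, ← ih]; rfl
  · simp only [List.mem_append, Finset.mem_toList, Finite.mem_toFinset, List.mem_map]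
    constructor
    · rintro (h | ⟨i, -, rfl⟩)
      · exact h
      · exact ⟨[i], Or.inl ⟨i, rfl⟩, rfl⟩
    · exact fun h => Or.inl h

theorem negGeneralPoints_nonempty {C : Finset (List (Fin d))} {q : M}
    (h : S.SatisfiesLARC g C q) : (S.negGeneralPoints g C q).Nonempty := by
  obtain ⟨w, hw⟩ := exists_notMem_exceptionalSet h
  obtain ⟨w', hw'⟩ := exists_isGeneralWord_append C w
  have key : ∀ w' : List (Fin d), ∃ t : Fin (w' ++ w).length → ℝ,
      (∀ i, t i < 0) ∧ t ∉ S.exceptionalSet g (w' ++ w) q := by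
    intro w'
    induction w' with
    | nil => exact hw
    | cons i w' ih =>
      obtain ⟨t, ht, htq⟩ := ih
      refine ⟨(Fin.cons (-1) t : Fin ((w' ++ w).length + 1) → ℝ), fun j => ?_,
        cons_notMem_exceptionalSet htq i (-1)⟩
      exact Fin.cases (by simp) (fun j => by simpa using ht j) j
  obtain ⟨t, ht, htq⟩ := key w'
  exact ⟨_, _, hw', t, ht, htq, rfl⟩

/-- General points form an open set: at a regular time the chronological product is open, and
nearby times are regular and negative too. -/
theorem isOpen_negGeneralPoints (C : Finset (List (Fin d))) (q : M) :
    IsOpen (S.negGeneralPoints g C q) := by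
  rw [isOpen_iff_mem_nhds]
  rintro _ ⟨w, hw, t, ht, htq, rfl⟩
  set c := S.chron g w t q
  set φ := chartAt (EuclideanSpace ℝ (Fin n)) c
  have hc : S.chron g w t q ∈ φ.source := mem_chart_source _ c
  have hd := contDiffAt_chart_chron (S := S) (g := g) w q hc
  have hsurj := (notMem_exceptionalSet_iff hc).1 htq
  have h1 : ∀ᶠ s in 𝓝 t, S.chron g w s q ∈ φ.source :=
    (contMDiff_chron w q).continuous.continuousAt.eventually_mem (φ.open_source.mem_nhds hc)
  have h2 : ∀ᶠ s in 𝓝 t, ∀ i, s i < 0 := Filter.eventually_all.2 fun i =>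
    (continuous_apply i).continuousAt.eventually_mem (isOpen_Iio.mem_nhds (ht i))
  have h3 : ∀ᶠ s in 𝓝 t, s ∉ S.exceptionalSet g w q := by
    have := ((hd.fderiv_right (m := 0) (by simp)).continuousAt).eventually
      (ContinuousLinearMap.eventually_surjective hsurj)
    filter_upwards [this, h1] with s hs hs1
    exact (notMem_exceptionalSet_iff hs1).2 hs
  have hstrict := hd.hasStrictFDerivAt (by simp)
  have hmap := hstrict.map_nhds_eq_of_surj (LinearMap.range_eq_top.2 hsurj)
  have hmem : ∀ᶠ y in 𝓝 (φ c), φ.symm y ∈ S.negGeneralPoints g C q := by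
    rw [← hmap, Filter.eventually_map]
    filter_upwards [h1, h2, h3] with s hs1 hs2 hs3
    rw [φ.left_inv hs1]
    exact ⟨w, hw, s, hs2, hs3, rfl⟩
  filter_upwards [(φ.continuousAt hc).eventually hmem, φ.open_source.mem_nhds hc] with x hx hx'
  rwa [φ.left_inv hx'] at hx

theorem mem_reachable_chron [Nonempty U] {A : Set (ℝ → U)} (hA : S.IsAdmissibleClass A) (q : M)
    (w : List (Fin d)) {t : Fin w.length → ℝ} (ht : ∀ i, t i < 0) :
    q ∈ S.reachable A (S.chron g w t q) := by
  induction w with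
  | nil => exact mem_reachable_self hA q
  | cons i w ih =>
    refine reachable_trans hA ?_ (ih (t := Fin.tail t) fun j => ht j.succ)
    rw [chron_cons]
    have := flow_mem_reachable hA (g i) (S.flow (g i) (t 0) (S.chron g w (Fin.tail t) q))
      (t := -t 0) (neg_nonneg.2 (ht 0).le)
    rwa [flow_neg_flow] at this

end ControlSystem

theorem theorem2 {U : Type*} [Nonempty U] {n : ℕ} {M : Type*} [TopologicalSpace M] [T2Space M]
    [ChartedSpace (EuclideanSpace ℝ (Fin n)) M] [IsManifold (𝓡 n) ∞ M]
    (S : ControlSystem U n M) (A : Set (ℝ → U)) (hA : S.IsAdmissibleClass A)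
    (q : M) {d : ℕ} (g : Fin d → U) (C : Finset (List (Fin d)))
    (hLARC : S.SatisfiesLARC g C q) :
    IsOpen (S.negGeneralPoints g C q) ∧
    (S.negGeneralPoints g C q).Nonempty ∧
    (∀ p ∈ S.negGeneralPoints g C q, q ∈ S.reachable A p) ∧
    ∀ u ∈ A, ∀ (γ : ℝ → M) (T : ℝ), S.IsTrajectory u γ T → γ 0 = q → γ T = q →
      S.IsGeneralInto g C q γ T →
      ∃ B : Set M, IsOpen B ∧ γ '' Icc 0 T ⊆ B ∧ ∀ q' ∈ B, q ∈ S.reachable A q' := by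
  have hreach : ∀ p ∈ S.negGeneralPoints g C q, q ∈ S.reachable A p := by
    rintro _ ⟨w, -, t, ht, -, rfl⟩
    exact ControlSystem.mem_reachable_chron hA q w ht
  have hopen := S.isOpen_negGeneralPoints (g := g) C q
  refine ⟨hopen, ControlSystem.negGeneralPoints_nonempty hLARC, hreach, ?_⟩
  rintro u hu γ T hγ h0 hT ⟨-, s, hs0, hsT, hs⟩
  set B : Set M := {x | q ∈ S.reachable A x}
  have hB : ∀ x, ∀ y ∈ B, y ∈ S.reachable A x → x ∈ B := fun x y hy hxy =>
    ControlSystem.reachable_trans hA hxy hy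
  have hsB : γ s ∈ interior B := interior_maximal hreach hopen hs
  -- the trajectory returns to its starting point, which lies before `s`
  have hTB : γ T ∈ interior B := by
    rw [hT, ← h0]
    exact hγ.mem_interior_of_le hA hB hu le_rfl hs0 hsT.le hsB
  refine ⟨interior B, isOpen_interior, ?_, fun x hx => (interior_subset hx : x ∈ B)⟩
  rintro _ ⟨t, ht, rfl⟩
  exact hγ.mem_interior_of_le hA hB hu ht.1 ht.2 le_rfl hTB
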